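/- Let $\Lambda_{\mathbb Q}=\mathbb Q[p_1,p_2,\dots]$ be the ring of symmetric functions over $\mathbb Q$ in the variables $x=(x_1,x_2,\dots)$, where $p_k=\sum_i x_i^k$, and let $\omega$ be its standard involution, the algebra homomorphism with $\omega(p_k)=(-1)^{k-1}p_k$. For $f\in\Lambda_{\mathbb Q}$ put $f(x/y)=\omega_y f(x,y)$, where $y=(y_1,y_2,\dots)$ is a second set of variables and $\omega_y$ is $\omega$ acting on the $y$ variables only, and let $f(x/x)$ be obtained from $f(x/y)$ by setting $y=x$; equivalently, $f(x/x)$ arises from $f$, written as a polynomial in the $p_k$, by $p_k\mapsto 2p_k$ for odd $k$ and $p_k\mapsto 0$ for even $k$. A parking function of length $n$ is a sequence $(a_1,\dots,a_n)$ of positive integers whose increasing rearrangement $b_1\le\cdots\le b_n$ satisfies $b_i\le i$ for all $i$. The symmetric group $\mathfrak S_n$ acts on the set of parking functions of length $n$ by permuting coordinates. Let $\mathrm{PF}_n=\frac1{n!}\sum_{w\in\mathfrak S_n}\chi(w)\,p_{\rho(w)}$ be the Frobenius characteristic of this action, where $\chi$ is the character of the permutation representation, $\rho(w)$ is the cycle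 type of $w$ and $p_\mu=p_{\mu_1}p_{\mu_2}\cdots$. Put $\mathrm{SH}_n(x)=\mathrm{PF}_n(x/x)$. For a partition $\lambda$ with distinct parts let $\ell(\lambda)$ be its number of parts and let $P_\lambda$ be Schur's $P$-function, $P_\lambda(x)=\sum_T x^T$. Here $T$ ranges over the fillings of the shifted diagram of $\lambda$ with letters from $1'<1<2'<2<\cdots$ that increase weakly along rows and down columns, have each $k'$ at most once in every row and each $k$ at most once in every column, and have no marked letter $k'$ on the main diagonal; $x^T$ is the product, over all cells, of $x_k$ where the entry is $k$ or $k'$. For a symmetric function $f$ let $f(1^{m})$ be its value at $x_1=\cdots=x_m=1$, $x_i=0$ for $i>m$. Then for every integer $n\ge 0$, $$ \mathrm{SH}_n(x)=\frac{1}{n+1}\sum_{\lambda} 2^{\ell(\lambda)}\,P_\lambda(1^{n+1})\,P_\lambda(x), $$ where $\lambda$ ranges over all partitions of $n$ into distinct parts. -/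

import Mathlib

open scoped TensorProduct

noncomputable section

/-! ### Symmetric functions over `ℚ` in the variables `x 0, x 1, x 2, …` -/

namespace ShiftedParking

/-- Formal power series over `ℚ` in countably many variables. -/
abbrev Series : Type := MvPowerSeries ℕ ℚ

open Classical in
/-- The power sum `p_k = ∑ i, x_i ^ k` for `k ≥ 1`, given by its coefficients. -/
def powerSum (k : ℕ) : Series := fun d => if ∃ i, d = Finsupp.single i k then 1 else 0

/-- The ring `Λ_ℚ = ℚ[p₁, p₂, …]` of symmetric functions, as a ring of power series. -/
def Sym : Subalgebra ℚ Series := Algebra.adjoin ℚ (Set.range fun i : ℕ => powerSum (i + 1))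

theorem coeff_powerSum (k : ℕ) (d : ℕ →₀ ℕ) [Decidable (∃ i, d = Finsupp.single i k)] :
    MvPowerSeries.coeff d (powerSum k) = if ∃ i, d = Finsupp.single i k then 1 else 0 := by
  rw [MvPowerSeries.coeff_apply]
  unfold powerSum
  congr

theorem pderiv_powerSum (j k : ℕ) :
    MvPowerSeries.pderiv ℚ j (powerSum (k + 1)) =
      ((k : ℚ) + 1) • (MvPowerSeries.X j : Series) ^ k := by
  classical
  ext d
  rw [MvPowerSeries.coeff_pderiv, coeff_powerSum, MvPowerSeries.coeff_smul,
    MvPowerSeries.coeff_X_pow]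
  have key : (∃ i, d + Finsupp.single j 1 = Finsupp.single i (k + 1)) ↔ d = Finsupp.single j k := by
    constructor
    · rintro ⟨i, hi⟩
      have hij : j = i := by
        by_contra hne
        have := DFunLike.congr_fun hi j
        simp [Ne.symm hne] at this
      subst hij
      rw [Finsupp.single_add] at hi
      exact add_right_cancel hi
    · rintro rfl
      exact ⟨j, by rw [Finsupp.single_add]⟩
  by_cases h : d = Finsupp.single j k
  · rw [if_pos (key.2 h), if_pos h, h]
    simp
  · rw [if_neg (fun h' => h (key.1 h')), if_neg h]
    simp

theorem pderiv_aeval_powerSum (s : Finset ℕ) (j : ℕ) (F : MvPolynomial s ℚ) :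
    MvPowerSeries.pderiv ℚ j (MvPolynomial.aeval (fun i : s => powerSum (i + 1)) F) =
      ∑ i : s, MvPolynomial.aeval (fun i : s => powerSum (i + 1)) (MvPolynomial.pderiv i F) *
        MvPowerSeries.pderiv ℚ j (powerSum (i + 1)) := by
  classical
  induction F using MvPolynomial.induction_on with
  | C a => simp
  | add p q hp hq => simp only [map_add, hp, hq, add_mul, Finset.sum_add_distrib]
  | mul_X p k hp =>
    rw [map_mul, MvPolynomial.aeval_X, Derivation.leibniz, hp]
    simp only [MvPolynomial.pderiv_mul, map_add, map_mul, MvPolynomial.aeval_X, add_mul,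
      Finset.sum_add_distrib, smul_eq_mul, Finset.mul_sum, MvPolynomial.pderiv_X]
    rw [add_comm]
    congr 1
    · exact Finset.sum_congr rfl fun i _ => by ring
    · rw [Finset.sum_eq_single k]
      · simp
      · intro i _ hi
        simp [hi.symm]
      · simp

theorem aeval_pderiv_eq_zero (s : Finset ℕ) (F : MvPolynomial s ℚ)
    (hF : MvPolynomial.aeval (fun i : s => powerSum (i + 1)) F = 0) (i : s) :
    MvPolynomial.aeval (fun i : s => powerSum (i + 1)) (MvPolynomial.pderiv i F) = 0 := by
  classical
  let G : s → Series := fun i =>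
    (((i : ℕ) : ℚ) + 1) • MvPolynomial.aeval (fun i : s => powerSum (i + 1))
      (MvPolynomial.pderiv i F)
  let Q : Polynomial Series := ∑ i : s, Polynomial.monomial (i : ℕ) (G i)
  have : IsDomain Series := NoZeroDivisors.to_isDomain _
  have hQ : Q = 0 := by
    apply Polynomial.eq_zero_of_infinite_isRoot
    refine (Set.infinite_range_of_injective (f := fun j : ℕ => (MvPowerSeries.X j : Series))
      fun a b hab => MvPowerSeries.X_inj.1 hab).mono ?_
    rintro _ ⟨j, rfl⟩
    have h := pderiv_aeval_powerSum s j F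
    rw [hF, map_zero] at h
    simp only [Set.mem_ofPred_eq, Polynomial.IsRoot, Q, Polynomial.eval_finsetSum,
      Polynomial.eval_monomial, G]
    rw [h]
    refine Finset.sum_congr rfl fun i _ => ?_
    rw [pderiv_powerSum, smul_mul_assoc, mul_smul_comm]
  have hi := congrArg (fun q => Polynomial.coeff q (i : ℕ)) hQ
  simp only [Q, Polynomial.finsetSum_coeff, Polynomial.coeff_monomial, Polynomial.coeff_zero,
    Subtype.coe_inj, Finset.sum_ite_eq', Finset.mem_univ, if_true, G] at hi
  exact (smul_eq_zero.1 hi).resolve_left (by positivity)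

theorem coeff_eq_zero_of_aeval_powerSum (s : Finset ℕ) (k : ℕ) : ∀ F : MvPolynomial s ℚ,
    MvPolynomial.aeval (fun i : s => powerSum (i + 1)) F = 0 →
      ∀ d : s →₀ ℕ, d.degree = k → MvPolynomial.coeff d F = 0 := by
  classical
  induction k with
  | zero =>
    intro F hF d hd
    obtain rfl : d = 0 := (Finsupp.degree_eq_zero_iff d).1 hd
    have h := congrArg (MvPowerSeries.constantCoeff (σ := ℕ) (R := ℚ)) hF
    rw [map_zero, MvPolynomial.aeval_def, MvPolynomial.hom_eval₂] at h
    have h0 : (fun i : s => MvPowerSeries.constantCoeff (powerSum ((i : ℕ) + 1))) = 0 := by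
      funext i
      rw [← MvPowerSeries.coeff_zero_eq_constantCoeff_apply, coeff_powerSum, if_neg]
      · rfl
      · rintro ⟨j, hj⟩
        have := DFunLike.congr_fun hj j
        simp at this
    rw [h0, show (MvPowerSeries.constantCoeff (σ := ℕ) (R := ℚ)).comp (algebraMap ℚ Series) =
      RingHom.id ℚ from RingHom.ext_rat _ _] at h
    rw [MvPolynomial.eval₂_id] at h
    rw [← MvPolynomial.constantCoeff_eq, ← MvPolynomial.eval_zero]
    exact h
  | succ k ih =>
    intro F hF d hd
    have hne : d ≠ 0 := by rintro rfl; simp at hd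
    obtain ⟨i, hi⟩ := Finsupp.ne_iff.1 hne
    have hd' : d = (d - Finsupp.single i 1) + Finsupp.single i 1 := by
      rw [tsub_add_cancel_of_le]
      rw [Finsupp.single_le_iff]
      exact Nat.one_le_iff_ne_zero.2 hi
    generalize d - Finsupp.single i 1 = e at hd'
    subst hd'
    have h := ih _ (aeval_pderiv_eq_zero s F hF i) e (by simpa using hd)
    rw [MvPolynomial.coeff_pderiv] at h
    exact (mul_eq_zero.1 h).resolve_right (by positivity)

/-- The power sums `p₁, p₂, …` are algebraically independent. -/
theorem algebraicIndependent_powerSum :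
    AlgebraicIndependent ℚ (fun i : ℕ => powerSum (i + 1)) := by
  rw [algebraicIndependent_iff]
  intro F hF
  obtain ⟨s, q, rfl⟩ := MvPolynomial.exists_finset_rename F
  rw [MvPolynomial.aeval_rename] at hF
  have hq : q = 0 := by
    ext d
    exact coeff_eq_zero_of_aeval_powerSum s _ q hF d rfl
  rw [hq, map_zero]

/-- The identification of `Λ_ℚ` with the polynomial ring in the power sums. -/
def symEquiv : MvPolynomial ℕ ℚ ≃ₐ[ℚ] Sym := algebraicIndependent_powerSum.aevalEquiv

/-- The power sum `p_k`, `k ≥ 1`, as an element of `Λ_ℚ`. -/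
def symP (k : ℕ) : Sym := symEquiv (MvPolynomial.X (k - 1))

theorem coe_symP (k : ℕ) (hk : 1 ≤ k) : (symP k : Series) = powerSum k := by
  obtain ⟨k, rfl⟩ := Nat.exists_eq_add_of_le' hk
  exact (algebraicIndependent_powerSum.algebraMap_aevalEquiv _).trans
    (MvPolynomial.aeval_X _ _)

/-- The algebra homomorphism out of `Λ_ℚ` that sends `p_k` to `a k` for all `k ≥ 1`. -/
def symLift {A : Type*} [CommSemiring A] [Algebra ℚ A] (a : ℕ → A) : Sym →ₐ[ℚ] A :=
  (MvPolynomial.aeval fun i : ℕ => a (i + 1)).comp symEquiv.symm.toAlgHom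

theorem symLift_symP {A : Type*} [CommSemiring A] [Algebra ℚ A] (a : ℕ → A) (k : ℕ) (hk : 1 ≤ k) :
    symLift a (symP k) = a k := by
  obtain ⟨k, rfl⟩ := Nat.exists_eq_add_of_le' hk
  simp [symLift, symP]

/-- The involution `ω` on symmetric functions, `ω p_k = (-1)^(k-1) p_k`. -/
def omega : Sym →ₐ[ℚ] Sym := symLift fun k => (-1 : ℚ) ^ (k - 1) • symP k

/-- `f ↦ f(x, y)`, where `Λ_ℚ ⊗ Λ_ℚ` is the ring of functions symmetric in `x` and in `y`
separately; here `p_k(x, y) = p_k(x) + p_k(y)`. -/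
def twoAlphabets : Sym →ₐ[ℚ] Sym ⊗[ℚ] Sym := symLift fun k => symP k ⊗ₜ[ℚ] 1 + 1 ⊗ₜ[ℚ] symP k

/-- The superfication `f(x/y) = ω_y f(x, y)`. -/
def superfication : Sym →ₐ[ℚ] Sym ⊗[ℚ] Sym :=
  (Algebra.TensorProduct.map (AlgHom.id ℚ Sym) omega).comp twoAlphabets

/-- The shiftification `f(x/x)`: set `y = x` in the superfication. -/
def shiftification : Sym →ₐ[ℚ] Sym := (Algebra.TensorProduct.lmul' ℚ).comp superfication

/-! ### Parking functions -/

/-- `a` is a parking function of length `n`: the entries are positive and the increasing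
rearrangement `b₁ ≤ … ≤ bₙ` of `a` satisfies `bᵢ ≤ i`. -/
def IsParking {n : ℕ} (a : Fin n → ℕ) : Prop :=
  (∀ i, 1 ≤ a i) ∧ ∀ i : Fin n, (a ∘ Tuple.sort a) i ≤ (i : ℕ) + 1

/-- The set of parking functions of length `n`. -/
def ParkingFunction (n : ℕ) : Type := {a : Fin n → ℕ // IsParking a}

theorem IsParking.comp_perm {n : ℕ} {a : Fin n → ℕ} (ha : IsParking a)
    (s : Equiv.Perm (Fin n)) : IsParking (a ∘ s) :=
  ⟨fun i => ha.1 (s i), fun i => by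
    rw [Tuple.comp_perm_comp_sort_eq_comp_sort]; exact ha.2 i⟩

/-- The symmetric group permutes the coordinates of parking functions. -/
instance (n : ℕ) : MulAction (Equiv.Perm (Fin n)) (ParkingFunction n) where
  smul s a := ⟨a.1 ∘ ⇑s⁻¹, a.2.comp_perm s⁻¹⟩
  one_smul _ := rfl
  mul_smul s t a := Subtype.ext (by
    change a.1 ∘ ⇑(s * t)⁻¹ = (a.1 ∘ ⇑t⁻¹) ∘ ⇑s⁻¹
    rw [mul_inv_rev]; rfl)

/-- The power sum `p_μ = p_{μ₁} p_{μ₂} ⋯`. -/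
def symPPart {m : ℕ} (μ : m.Partition) : Sym := (μ.parts.map symP).prod

/-- The Frobenius characteristic `(1/n!) ∑ w, χ(w) p_{ρ(w)}` of a function `χ` on the symmetric
group, where `ρ(w)` is the cycle type of `w` (with the fixed points as parts `1`). -/
def frobeniusCh {n : ℕ} (χ : Equiv.Perm (Fin n) → ℚ) : Sym :=
  ((n.factorial : ℚ)⁻¹) • ∑ w : Equiv.Perm (Fin n), χ w • symPPart w.partition

/-- The parking function symmetric function: the Frobenius characteristic of the permutation
representation of the symmetric group on parking functions. -/
def parkingSym (n : ℕ) : Sym :=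
  frobeniusCh (Representation.ofMulAction ℚ (Equiv.Perm (Fin n)) (ParkingFunction n)).character

/-- The shifted parking function symmetric function `PF_n(x/x)`. -/
def shiftedParkingSym (n : ℕ) : Sym := shiftification (parkingSym n)

/-! ### Schur P-functions -/

/-- The part `λ_{i+1}` of a partition written in decreasing order, `0` beyond the length. -/
def rowLen {n : ℕ} (lam : n.Partition) (i : ℕ) : ℕ := (lam.parts.sort (· ≥ ·)).getD i 0

/-- The shifted diagram of a partition with distinct parts: row `i` is moved `i` steps to the
right, so that it occupies the columns `i, …, i + λ_{i+1} - 1`. -/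
def shiftedDiagram {n : ℕ} (lam : n.Partition) : Finset (ℕ × ℕ) :=
  (Finset.range lam.parts.card).biUnion fun i => {i} ×ˢ Finset.Ico i (i + rowLen lam i)

/-- The alphabet `0' < 0 < 1' < 1 < 2' < 2 < ⋯`: the letter `(k, false)` is the marked letter `k'`
and `(k, true)` is the unmarked letter `k`. -/
abbrev Letter : Type := ℕ ×ₗ Bool

/-- The absolute value `k` of the letters `k'` and `k`. -/
def Letter.abs (a : Letter) : ℕ := (ofLex a).1

/-- Whether a letter is marked. -/
def Letter.Marked (a : Letter) : Prop := (ofLex a).2 = false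

/-- Marked shifted tableaux of a given shape with no marked letters on the main diagonal. -/
structure MarkedShiftedTableau {n : ℕ} (lam : n.Partition) where
  /-- the entries -/
  entry : shiftedDiagram lam → Letter
  row_le : ∀ c d, c.1.1 = d.1.1 → c.1.2 ≤ d.1.2 → entry c ≤ entry d
  col_le : ∀ c d, c.1.2 = d.1.2 → c.1.1 ≤ d.1.1 → entry c ≤ entry d
  /-- each row contains each marked letter at most once -/
  row_marked : ∀ c d, c.1.1 = d.1.1 → c.1.2 < d.1.2 → entry c = entry d → ¬ (entry c).Marked
  /-- each column contains each unmarked letter at most once -/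
  col_unmarked : ∀ c d, c.1.2 = d.1.2 → c.1.1 < d.1.1 → entry c = entry d → (entry c).Marked
  diag_unmarked : ∀ c, c.1.1 = c.1.2 → ¬ (entry c).Marked

/-- The exponent vector of the monomial `x^T = ∏ x_{|T(c)|}` over the cells `c`. -/
def MarkedShiftedTableau.weight {n : ℕ} {lam : n.Partition} (T : MarkedShiftedTableau lam) :
    ℕ →₀ ℕ :=
  ∑ c, Finsupp.single (T.entry c).abs 1

/-- Schur's P-function `P_λ = ∑ T, x^T`, `λ` with distinct parts: the coefficient of `x^d` is the
(finite) number of marked shifted tableaux `T` of shape `λ` and weight `d` with unmarked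
diagonal. -/
def schurP {n : ℕ} (lam : n.Partition) : Series :=
  fun d => (Nat.card {T : MarkedShiftedTableau lam // T.weight = d} : ℚ)

/-- The value `f(1^m)` of a series of bounded degree at `x_i = 1` for the first `m` variables and
`x_i = 0` for the others: the sum of the coefficients of the monomials in the first `m` variables
(a finite sum). -/
def evalOnes (m : ℕ) (f : Series) : ℚ :=
  ∑ᶠ (d : ℕ →₀ ℕ) (_ : ∀ i, m ≤ i → d i = 0), MvPowerSeries.coeff d f

end ShiftedParking

end

/-! Rotating functions on a circle of `n + 1` places shows that a permutation with `ℓ` cycles fixes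
`(n + 1) ^ (ℓ - 1)` parking functions (`card_fixed_mul`). Hence `(n + 1) PF_n` is the complete
homogeneous function `h_n` with every `p_k` replaced by `(n + 1) p_k`. Shiftification turns `p_k`
into `∑ (x_i ^ k - (-x_i) ^ k)`, so `(n + 1) SH_n` is the coefficient of `t ^ n` in `∏ ((1 + t x_i)
/ (1 - t x_i)) ^ (n + 1)` (`prod_mul_mk_cycleIndex`). This product is the Cauchy kernel `∑ Q_λ(y)
P_λ(x)`, with `Q_λ = 2 ^ ℓ(λ) P_λ`, at `y = 1 ^ (n + 1)`.

The Cauchy identity (`coeff_cauchy`) rests on a commutation rule for adding and removing strips: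
summing `P_{μ/β}(x) Q_{μ/α}(y)` over upper shapes `μ` gives `(1 + xy) / (1 - xy)` times the sum of
`P_{α/ν}(x) Q_{β/ν}(y)` over lower shapes `ν`. One-variable skew functions are products of local
factors along the diagonals of the shape, so the rule, cut off at parts of size at most `L`, can be
proved by adding one position at a time (`exchange`). The cut-off only causes errors of degree above
`L`.

The functions in the Cauchy identity are defined by branching, one variable at a time. They agree
with the tableau definition because the cells holding the last letter can be stripped off
(`tabExtend_bijective`), and because a `k'`-strip followed by a `k`-strip has total weight `2` to
the number of components off the diagonal (`stripWeight_one_eq_markedSum`). The comparison is made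
in finitely many variables, which is enough to determine a series. -/

noncomputable section

namespace ShiftedParking

/-! ### Strict partitions as finite sets, and transfer weights of strips

A strict partition is encoded by the finite set `A` of all `a` such that `a + 1` is a part.  The
weight of a strip `A / B` is computed by scanning the positions from the top to the bottom while
recording the edge bit `#{a ∈ A | p ≤ a} - #{b ∈ B | p ≤ b}`, the number of cells of content `p`. -/

variable {R : Type*} [CommRing R]

/-- The indicator function of `A`, with values in `ℤ`. -/
def bit (A : Finset ℕ) (p : ℕ) : ℤ := if p ∈ A then 1 else 0

/-- The weight of the part in positions below `L` of the strip `A / B`, where `e` is the edge bit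
above position `L - 1`: each cell has weight `x`, each connected component that does not meet the
diagonal has weight `2`, and the one that meets the diagonal has weight `z`. -/
def stripWeight (z x : R) (B A : Finset ℕ) : ℕ → ℤ → R
  | 0, e => if e = 0 then 1 else if e = 1 then z * x else 0
  | L + 1, e =>
    (if e = 0 then 1 else if e = 1 then (if L ∈ B ∧ L ∉ A then 2 * x else x) else 0) *
      stripWeight z x B A L (e + bit A L - bit B L)

theorem stripWeight_eq_zero (z x : R) (B A : Finset ℕ) (L : ℕ) {e : ℤ} (h0 : e ≠ 0) (h1 : e ≠ 1) :
    stripWeight z x B A L e = 0 := by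
  cases L <;> simp [stripWeight, h0, h1]

theorem bit_congr {A A' : Finset ℕ} {L : ℕ} (h : ∀ p < L, p ∈ A ↔ p ∈ A') {p : ℕ} (hp : p < L) :
    bit A p = bit A' p := by
  simp [bit, h p hp]

theorem stripWeight_congr (z x : R) {B B' A A' : Finset ℕ} {L : ℕ}
    (hB : ∀ p < L, p ∈ B ↔ p ∈ B') (hA : ∀ p < L, p ∈ A ↔ p ∈ A') (e : ℤ) :
    stripWeight z x B A L e = stripWeight z x B' A' L e := by
  induction L generalizing e with
  | zero => rfl
  | succ L ih =>
    simp only [stripWeight]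
    rw [ih (fun p hp => hB p (by omega)) (fun p hp => hA p (by omega)),
      bit_congr hB (Nat.lt_succ_self L), bit_congr hA (Nat.lt_succ_self L)]
    simp [hB L (Nat.lt_succ_self L), hA L (Nat.lt_succ_self L)]

theorem mem_insert_of_lt {A : Finset ℕ} {L p : ℕ} (hp : p < L) : p ∈ insert L A ↔ p ∈ A := by
  simp [hp.ne]

theorem stripWeight_insert_right (z x : R) (B A : Finset ℕ) (L : ℕ) (e : ℤ) :
    stripWeight z x B (insert L A) L e = stripWeight z x B A L e :=
  stripWeight_congr z x (fun _ _ => Iff.rfl) (fun _ hp => mem_insert_of_lt hp) e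

theorem stripWeight_insert_left (z x : R) (B A : Finset ℕ) (L : ℕ) (e : ℤ) :
    stripWeight z x (insert L B) A L e = stripWeight z x B A L e :=
  stripWeight_congr z x (fun _ hp => mem_insert_of_lt hp) (fun _ _ => Iff.rfl) e

theorem sum_powerset_range_succ {M : Type*} [AddCommMonoid M] (L : ℕ) (f : Finset ℕ → M) :
    ∑ A ∈ (Finset.range (L + 1)).powerset, f A =
      ∑ A ∈ (Finset.range L).powerset, (f A + f (insert L A)) := by
  rw [Finset.range_add_one, Finset.sum_powerset_insert Finset.notMem_range_self,
    Finset.sum_add_distrib]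

theorem notMem_of_mem_powerset_range {A : Finset ℕ} {L : ℕ}
    (hA : A ∈ (Finset.range L).powerset) : L ∉ A := fun h => by
  simpa using Finset.mem_powerset.1 hA h

/-! ### Commutation of adding and removing strips -/

/-- The sum over the common upper shapes of two strict partitions. -/
def upSum (x y : R) (α β : Finset ℕ) (L : ℕ) (e f : ℤ) : R :=
  ∑ μ ∈ (Finset.range L).powerset, stripWeight 1 x β μ L e * stripWeight 2 y α μ L f

/-- The sum over the common lower shapes of two strict partitions. -/
def downSum (x y : R) (α β : Finset ℕ) (L : ℕ) (e f : ℤ) : R :=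
  ∑ ν ∈ (Finset.range L).powerset, stripWeight 1 x ν α L e * stripWeight 2 y ν β L f

theorem upSum_succ (x y : R) (α β : Finset ℕ) (L : ℕ) (e f : ℤ) :
    upSum x y α β (L + 1) e f =
      (if e = 0 then 1 else if e = 1 then (if L ∈ β then 2 * x else x) else 0) *
        (if f = 0 then 1 else if f = 1 then (if L ∈ α then 2 * y else y) else 0) *
        upSum x y α β L (e - bit β L) (f - bit α L) +
      (if e = 0 then 1 else if e = 1 then x else 0) *
        (if f = 0 then 1 else if f = 1 then y else 0) *
        upSum x y α β L (e + 1 - bit β L) (f + 1 - bit α L) := by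
  simp only [upSum, sum_powerset_range_succ, Finset.sum_add_distrib, Finset.mul_sum]
  congr 1
  · refine Finset.sum_congr rfl fun μ hμ => ?_
    have h := notMem_of_mem_powerset_range hμ
    simp only [stripWeight, bit, h, if_false, not_false_iff, and_true, add_zero]
    ring
  · refine Finset.sum_congr rfl fun μ hμ => ?_
    simp only [stripWeight, stripWeight_insert_right]
    simp only [bit, Finset.mem_insert_self, not_true, and_false, if_true, if_false]
    ring

theorem downSum_succ (x y : R) (α β : Finset ℕ) (L : ℕ) (e f : ℤ) :
    downSum x y α β (L + 1) e f =
      (if e = 0 then 1 else if e = 1 then x else 0) *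
        (if f = 0 then 1 else if f = 1 then y else 0) *
        downSum x y α β L (e + bit α L) (f + bit β L) +
      (if e = 0 then 1 else if e = 1 then (if L ∉ α then 2 * x else x) else 0) *
        (if f = 0 then 1 else if f = 1 then (if L ∉ β then 2 * y else y) else 0) *
        downSum x y α β L (e + bit α L - 1) (f + bit β L - 1) := by
  simp only [downSum, sum_powerset_range_succ, Finset.sum_add_distrib, Finset.mul_sum]
  congr 1
  · refine Finset.sum_congr rfl fun μ hμ => ?_
    have h := notMem_of_mem_powerset_range hμ
    simp only [stripWeight, bit, h, if_false, false_and, sub_zero]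
    ring
  · refine Finset.sum_congr rfl fun μ hμ => ?_
    simp only [stripWeight, stripWeight_insert_left]
    simp only [bit, Finset.mem_insert_self, true_and, if_true]
    ring

theorem upSum_eq_zero (x y : R) (α β : Finset ℕ) (L : ℕ) {e f : ℤ}
    (h : (e ≠ 0 ∧ e ≠ 1) ∨ (f ≠ 0 ∧ f ≠ 1)) : upSum x y α β L e f = 0 := by
  refine Finset.sum_eq_zero fun μ _ => ?_
  rcases h with h | h <;> rw [stripWeight_eq_zero _ _ _ _ _ h.1 h.2] <;> simp

theorem downSum_eq_zero (x y : R) (α β : Finset ℕ) (L : ℕ) {e f : ℤ}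
    (h : (e ≠ 0 ∧ e ≠ 1) ∨ (f ≠ 0 ∧ f ≠ 1)) : downSum x y α β L e f = 0 := by
  refine Finset.sum_eq_zero fun μ _ => ?_
  rcases h with h | h <;> rw [stripWeight_eq_zero _ _ _ _ _ h.1 h.2] <;> simp

/-- The exchange relations between the sums over upper and lower shapes. -/
theorem exchange (x y : R) (α β : Finset ℕ) (L : ℕ) :
    (1 - x * y) * upSum x y α β L 0 0 + upSum x y α β L 1 1 =
        (1 + x * y) * downSum x y α β L 0 0 ∧
      2 * upSum x y α β L 0 0 + upSum x y α β L 1 1 =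
        2 * downSum x y α β L 0 0 + downSum x y α β L 1 1 ∧
      upSum x y α β L 1 0 = downSum x y α β L 1 0 ∧
      upSum x y α β L 0 1 = downSum x y α β L 0 1 := by
  induction L with
  | zero =>
    simp only [upSum, downSum, stripWeight, Finset.range_zero, Finset.powerset_empty,
      Finset.sum_singleton]
    refine ⟨?_, ?_, ?_, ?_⟩ <;> norm_num
    ring
  | succ L ih =>
    obtain ⟨h1, h2, h3, h4⟩ := ih
    have u (e f : ℤ) (h : (e ≠ 0 ∧ e ≠ 1) ∨ (f ≠ 0 ∧ f ≠ 1)) := upSum_eq_zero x y α β L h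
    have d (e f : ℤ) (h : (e ≠ 0 ∧ e ≠ 1) ∨ (f ≠ 0 ∧ f ≠ 1)) := downSum_eq_zero x y α β L h
    have u1 := fun f => u (-1) f (by norm_num)
    have u2 := fun f => u 2 f (by norm_num)
    have u3 := fun e => u e (-1) (by norm_num)
    have u4 := fun e => u e 2 (by norm_num)
    have d1 := fun f => d (-1) f (by norm_num)
    have d2 := fun f => d 2 f (by norm_num)
    have d3 := fun e => d e (-1) (by norm_num)
    have d4 := fun e => d e 2 (by norm_num)
    -- Edge bits other than 0 and 1 contribute nothing, so only four boundary states survive. The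
    -- first relation is not stable under the recursion by itself; together the four are, and each
    -- goal is a linear combination of them.
    by_cases hα : L ∈ α <;> by_cases hβ : L ∈ β <;>
      simp only [upSum_succ, downSum_succ, bit, hα, hβ, if_true, if_false] <;>
      norm_num [u1, u2, u3, u4, d1, d2, d3, d4]
    · exact ⟨by linear_combination (1 + x * y) * h2 - h1,
        by linear_combination (2 + x * y) * h2 - 2 * h1, by rw [h3], by rw [h4]⟩
    · exact ⟨by linear_combination (1 + x * y) * h3, by linear_combination (2 + 2 * x * y) * h3,
        by linear_combination y * h2⟩
    · exact ⟨by linear_combination (1 + x * y) * h4, by linear_combination (2 + 2 * x * y) * h4,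
        by linear_combination x * h2⟩
    · exact ⟨by linear_combination h1, by linear_combination x * y * h2 + 2 * h1, by rw [h3],
        by rw [h4]⟩

/-! ### The Cauchy identity -/

/-- The number of cells of the shape encoded by `A`. -/
def size (A : Finset ℕ) : ℕ := ∑ a ∈ A, (a + 1)

theorem sum_bit_mul {A : Finset ℕ} {L : ℕ} (hA : A ⊆ Finset.range L) (f : ℕ → ℤ) :
    ∑ p ∈ Finset.range L, bit A p * f p = ∑ a ∈ A, f a := by
  simp only [bit, ite_mul, one_mul, zero_mul]
  rw [← Finset.sum_filter, Finset.filter_mem_eq_inter, Finset.inter_eq_right.2 hA]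

theorem sum_bit_mul_eq_size {A : Finset ℕ} {L : ℕ} (hA : A ⊆ Finset.range L) :
    ∑ p ∈ Finset.range L, bit A p * (p + 1) = size A := by
  rw [sum_bit_mul hA]; simp [size]

theorem sum_bit_eq_card {A : Finset ℕ} {L : ℕ} (hA : A ⊆ Finset.range L) :
    ∑ p ∈ Finset.range L, bit A p = A.card := by
  simpa using sum_bit_mul hA 1

/-- The degree is the number of cells, which is the sum of the edge bits at contents `0, …, L`. The
bit at `p` is `e` plus the differences at positions `q ≥ p`; thus position `q` is counted `q + 1`
times and `e` is counted `L + 1` times. The case of zero weight is separate because the formula may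
then be negative. -/
theorem stripWeight_homogeneous (z : R) (B A : Finset ℕ) (L : ℕ) (e : ℤ) :
    (∀ x, stripWeight z x B A L e = 0) ∨
      ∃ k : ℕ, (k : ℤ) = ∑ p ∈ Finset.range L, (bit A p - bit B p) * (p + 1) + e * (L + 1) ∧
        ∀ t x, stripWeight z (t * x) B A L e = t ^ k * stripWeight z x B A L e := by
  induction L generalizing e with
  | zero =>
    by_cases h0 : e = 0
    · exact Or.inr ⟨0, by simp [h0], by simp [h0, stripWeight]⟩
    by_cases h1 : e = 1
    · exact Or.inr ⟨1, by simp [h1], fun t x => by simp [h1, stripWeight]; ring⟩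
    exact Or.inl fun x => stripWeight_eq_zero _ _ _ _ _ h0 h1
  | succ L ih =>
    rcases ih (e + bit A L - bit B L) with h | ⟨k, hk, h⟩
    · exact Or.inl fun x => by simp [stripWeight, h]
    by_cases h0 : e = 0
    · refine Or.inr ⟨k, ?_, fun t x => ?_⟩
      · rw [hk, Finset.sum_range_succ, h0]; push_cast; ring
      · simp only [stripWeight, h, if_pos h0, one_mul]
    by_cases h1 : e = 1
    · refine Or.inr ⟨k + 1, ?_, fun t x => ?_⟩
      · rw [Nat.cast_succ, hk, Finset.sum_range_succ, h1]; push_cast; ring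
      · simp only [stripWeight, h, if_pos h1, if_neg h0]
        split_ifs <;> ring
    exact Or.inl fun x => stripWeight_eq_zero _ _ _ _ _ h0 h1

theorem sum_bit_sub_mul {B A : Finset ℕ} {L : ℕ} (hB : B ⊆ Finset.range L)
    (hA : A ⊆ Finset.range L) :
    ∑ p ∈ Finset.range L, (bit A p - bit B p) * (p + 1) = (size A : ℤ) - size B := by
  simp only [sub_mul, Finset.sum_sub_distrib, sum_bit_mul_eq_size hB, sum_bit_mul_eq_size hA]

/-- Replacing `z = 1` by `z = 2` only affects the cell on the main diagonal, and a cell there is the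
same as one additional part. The exponent is the edge bit at content 0. -/
theorem stripWeight_two_eq (x : R) (B A : Finset ℕ) (L : ℕ) (e : ℤ) :
    (stripWeight 1 x B A L e = 0 ∧ stripWeight 2 x B A L e = 0) ∨
      ∃ k : ℕ, (k : ℤ) = ∑ p ∈ Finset.range L, (bit A p - bit B p) + e ∧
        stripWeight 2 x B A L e = 2 ^ k * stripWeight 1 x B A L e := by
  induction L generalizing e with
  | zero =>
    by_cases h0 : e = 0
    · exact Or.inr ⟨0, by simp [h0], by simp [h0, stripWeight]⟩
    by_cases h1 : e = 1
    · exact Or.inr ⟨1, by simp [h1], by simp [h1, stripWeight]⟩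
    exact Or.inl (by simp [stripWeight, h0, h1])
  | succ L ih =>
    rcases ih (e + bit A L - bit B L) with h | ⟨k, hk, h⟩
    · exact Or.inl (by simp [stripWeight, h])
    · refine Or.inr ⟨k, ?_, ?_⟩
      · rw [hk, Finset.sum_range_succ]; ring
      · simp only [stripWeight, h]; ring

theorem stripWeight_self (z x : R) (A : Finset ℕ) (L : ℕ) : stripWeight z x A A L 0 = 1 := by
  induction L with
  | zero => simp [stripWeight]
  | succ L ih => simp [stripWeight, ih]

theorem stripWeight_empty_right (z x : R) {B : Finset ℕ} {L : ℕ} (hB : B ⊆ Finset.range L) :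
    stripWeight z x B ∅ L 0 = if B = ∅ then 1 else 0 := by
  split_ifs with h
  · rw [h, stripWeight_self]
  · rcases stripWeight_homogeneous z B ∅ L 0 with h' | ⟨k, hk, -⟩
    · exact h' x
    · rw [sum_bit_sub_mul hB (Finset.empty_subset _)] at hk
      obtain ⟨b, hb⟩ := Finset.nonempty_iff_ne_empty.2 h
      have : b + 1 ≤ size B := Finset.single_le_sum (f := fun a => a + 1) (by simp) hb
      have h0 : size ∅ = 0 := rfl
      omega

/-! ### Branching functions and the truncated Cauchy kernel -/

/-- The Schur `P`-function of a shape `A ⊆ {0, …, L - 1}` in `N` variables, defined by its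
branching rule. -/
def branchP (L : ℕ) (x : ℕ → R) : ℕ → Finset ℕ → R
  | 0, A => if A = ∅ then 1 else 0
  | N + 1, A => ∑ B ∈ (Finset.range L).powerset, stripWeight 1 (x N) B A L 0 * branchP L x N B

/-- The value at `1, …, 1` of the Schur `Q`-function, defined by its branching rule. -/
def branchQ (R : Type*) [CommRing R] (L : ℕ) : ℕ → Finset ℕ → R
  | 0, A => if A = ∅ then 1 else 0
  | N + 1, A => ∑ B ∈ (Finset.range L).powerset, stripWeight 2 1 B A L 0 * branchQ R L N B

/-- The factors `2 ^ (|A| - |B|)` of the successive strips telescope to one factor `2` per part. -/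
theorem branchQ_eq (L N : ℕ) {A : Finset ℕ} (hA : A ⊆ Finset.range L) :
    branchQ R L N A = 2 ^ A.card * branchP L (fun _ => (1 : R)) N A := by
  induction N generalizing A with
  | zero =>
    by_cases h : A = ∅ <;> simp [branchQ, branchP, h]
  | succ N ih =>
    simp only [branchQ, branchP, Finset.mul_sum]
    refine Finset.sum_congr rfl fun B hB => ?_
    rw [Finset.mem_powerset] at hB
    rw [ih hB]
    rcases stripWeight_two_eq (1 : R) B A L 0 with h | ⟨k, hk, h⟩
    · simp [h]
    · rw [Finset.sum_sub_distrib, sum_bit_eq_card hB, sum_bit_eq_card hA] at hk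
      rw [h, show A.card = k + B.card by omega]
      ring

theorem branchP_homogeneous (L : ℕ) (t : R) (x : ℕ → R) (N : ℕ) {A : Finset ℕ}
    (hA : A ⊆ Finset.range L) :
    branchP L (fun i => t * x i) N A = t ^ size A * branchP L x N A := by
  induction N generalizing A with
  | zero =>
    by_cases h : A = ∅ <;> simp [branchP, h, size]
  | succ N ih =>
    simp only [branchP, Finset.mul_sum]
    refine Finset.sum_congr rfl fun B hB => ?_
    rw [Finset.mem_powerset] at hB
    rw [ih hB]
    rcases stripWeight_homogeneous (1 : R) B A L 0 with h | ⟨k, hk, h⟩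
    · simp [h]
    · rw [sum_bit_sub_mul hB hA] at hk
      rw [h, show size A = k + size B by omega]
      ring

theorem branchP_empty (L : ℕ) (x : ℕ → R) (N : ℕ) : branchP L x N ∅ = 1 := by
  induction N with
  | zero => simp [branchP]
  | succ N ih =>
    rw [branchP, Finset.sum_eq_single ∅]
    · simp [ih, stripWeight_self]
    · intro B hB h
      rw [stripWeight_empty_right _ _ (Finset.mem_powerset.1 hB)]
      simp [h]
    · simp

theorem map_stripWeight {S : Type*} [CommRing S] (f : R →+* S) (z x : R) (B A : Finset ℕ) (L : ℕ)
    (e : ℤ) : f (stripWeight z x B A L e) = stripWeight (f z) (f x) B A L e := by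
  induction L generalizing e with
  | zero => simp only [stripWeight]; split_ifs <;> simp
  | succ L ih => simp only [stripWeight, map_mul, ih]; split_ifs <;> simp [map_ofNat]

theorem map_branchP {S : Type*} [CommRing S] (f : R →+* S) (L : ℕ) (x : ℕ → R) (N : ℕ)
    (A : Finset ℕ) : f (branchP L x N A) = branchP L (fun i => f (x i)) N A := by
  induction N generalizing A with
  | zero => simp only [branchP]; split_ifs <;> simp
  | succ N ih => simp only [branchP, map_sum, map_mul, ih, map_stripWeight, map_one]

/-- Bounds the error caused by the cut-off. The boundary state `(1, 1)` represents upper shapes `μ`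
with a part larger than `L`; summing over the possible lengths of that part gives a geometric
series, hence this term next to `1 - xy` in `exchange`. Its degree in `t` is at least `size μ + L +
1`, after the degree `size β` of the `P`-function is included. -/
theorem pow_dvd_branchP_mul_upSum (L : ℕ) (t w : R) (x : ℕ → R) (N : ℕ) (α : Finset ℕ)
    {β : Finset ℕ} (hβ : β ⊆ Finset.range L) :
    t ^ (L + 1) ∣ branchP L (fun i => t * x i) N β * upSum (t * w) 1 α β L 1 1 := by
  rw [upSum, Finset.mul_sum]
  refine Finset.dvd_sum fun μ hμ => ?_
  rw [Finset.mem_powerset] at hμ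
  rcases stripWeight_homogeneous (1 : R) β μ L 1 with h | ⟨k, hk, h⟩
  · simp [h]
  · rw [sum_bit_sub_mul hβ hμ] at hk
    rw [h, branchP_homogeneous L t x N hβ]
    refine (pow_dvd_pow t (show L + 1 ≤ size β + k by omega)).trans ⟨branchP L x N β *
      (stripWeight 1 w β μ L 1 * stripWeight 2 1 α μ L 1), ?_⟩
    ring

/-- This is the effect of one variable `y = 1` on `P_α(tx)`. Induction on the number of variables
`x_i`: `exchange` moves the `y`-strip past the strip of the last `x`, at the cost of a factor `(1 +
t x) / (1 - t x)` and an error of high order. -/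
theorem pow_dvd_sum_stripWeight_mul_branchP (L : ℕ) (t : R) (x : ℕ → R) (N : ℕ) {α : Finset ℕ}
    (hα : α ⊆ Finset.range L) :
    t ^ (L + 1) ∣ (∏ i ∈ Finset.range N, (1 - t * x i)) *
        (∑ μ ∈ (Finset.range L).powerset,
          stripWeight 2 1 α μ L 0 * branchP L (fun i => t * x i) N μ) -
      (∏ i ∈ Finset.range N, (1 + t * x i)) * branchP L (fun i => t * x i) N α := by
  induction N generalizing α with
  | zero =>
    rw [Finset.sum_eq_single ∅]
    · simp [branchP, stripWeight_empty_right _ _ hα]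
    · intro B _ h
      simp [branchP, h]
    · simp
  | succ N ih =>
    set Φ := branchP L (fun i => t * x i) N with hΦ
    set U := ∏ i ∈ Finset.range N, (1 - t * x i)
    set V := ∏ i ∈ Finset.range N, (1 + t * x i)
    -- Both sides are expanded over the shape `β` occupied by the first `N` variables; for each `β`
    -- the identity is the first relation of `exchange`.
    have h1 : (1 - t * x N) * (∑ μ ∈ (Finset.range L).powerset,
        stripWeight 2 1 α μ L 0 * branchP L (fun i => t * x i) (N + 1) μ) =
        (1 + t * x N) * (∑ ν ∈ (Finset.range L).powerset, stripWeight 1 (t * x N) ν α L 0 *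
          ∑ β ∈ (Finset.range L).powerset, stripWeight 2 1 ν β L 0 * Φ β) -
        ∑ β ∈ (Finset.range L).powerset, Φ β * upSum (t * x N) 1 α β L 1 1 := by
      have h2 : (∑ μ ∈ (Finset.range L).powerset,
          stripWeight 2 1 α μ L 0 * branchP L (fun i => t * x i) (N + 1) μ) =
          ∑ β ∈ (Finset.range L).powerset, Φ β * upSum (t * x N) 1 α β L 0 0 := by
        simp only [branchP, upSum, Finset.mul_sum]
        rw [Finset.sum_comm]
        refine Finset.sum_congr rfl fun β _ => Finset.sum_congr rfl fun μ _ => ?_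
        rw [← hΦ]; ring
      have h3 : (∑ ν ∈ (Finset.range L).powerset, stripWeight 1 (t * x N) ν α L 0 *
          ∑ β ∈ (Finset.range L).powerset, stripWeight 2 1 ν β L 0 * Φ β) =
          ∑ β ∈ (Finset.range L).powerset, Φ β * downSum (t * x N) 1 α β L 0 0 := by
        simp only [downSum, Finset.mul_sum]
        rw [Finset.sum_comm]
        refine Finset.sum_congr rfl fun β _ => Finset.sum_congr rfl fun μ _ => ?_
        ring
      rw [h2, h3, Finset.mul_sum, Finset.mul_sum, ← Finset.sum_sub_distrib]
      refine Finset.sum_congr rfl fun β _ => ?_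
      have := (exchange (t * x N) 1 α β L).1
      linear_combination Φ β * this
    have h4 : (∏ i ∈ Finset.range (N + 1), (1 - t * x i)) *
        (∑ μ ∈ (Finset.range L).powerset,
          stripWeight 2 1 α μ L 0 * branchP L (fun i => t * x i) (N + 1) μ) -
      (∏ i ∈ Finset.range (N + 1), (1 + t * x i)) * branchP L (fun i => t * x i) (N + 1) α =
        (1 + t * x N) * (∑ ν ∈ (Finset.range L).powerset, stripWeight 1 (t * x N) ν α L 0 *
          (U * (∑ β ∈ (Finset.range L).powerset, stripWeight 2 1 ν β L 0 * Φ β) - V * Φ ν)) -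
        U * ∑ β ∈ (Finset.range L).powerset, Φ β * upSum (t * x N) 1 α β L 1 1 := by
      have h5 : (∑ ν ∈ (Finset.range L).powerset, stripWeight 1 (t * x N) ν α L 0 *
          (U * (∑ β ∈ (Finset.range L).powerset, stripWeight 2 1 ν β L 0 * Φ β) - V * Φ ν)) =
          U * (∑ ν ∈ (Finset.range L).powerset, stripWeight 1 (t * x N) ν α L 0 *
          ∑ β ∈ (Finset.range L).powerset, stripWeight 2 1 ν β L 0 * Φ β) -
          V * branchP L (fun i => t * x i) (N + 1) α := by
        rw [branchP, ← hΦ, Finset.mul_sum, Finset.mul_sum, ← Finset.sum_sub_distrib]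
        exact Finset.sum_congr rfl fun ν _ => by ring
      rw [h5, Finset.prod_range_succ, Finset.prod_range_succ]
      linear_combination U * h1
    rw [h4]
    refine dvd_sub (Dvd.dvd.mul_left (Finset.dvd_sum fun ν hν => Dvd.dvd.mul_left
      (ih (Finset.mem_powerset.1 hν)) _) _) (Dvd.dvd.mul_left (Finset.dvd_sum fun β hβ => ?_) _)
    exact pow_dvd_branchP_mul_upSum L t (x N) x N α (Finset.mem_powerset.1 hβ)

/-- Induction on the number of variables `y = 1`: each one contributes the factor `∏ (1 + t x_i) /
(1 - t x_i)` modulo `t ^ (L + 1)`. -/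
theorem pow_dvd_cauchy (L : ℕ) (t : R) (x : ℕ → R) (N m : ℕ) :
    t ^ (L + 1) ∣ (∏ i ∈ Finset.range N, (1 - t * x i)) ^ m *
        (∑ A ∈ (Finset.range L).powerset, branchQ R L m A * branchP L (fun i => t * x i) N A) -
      (∏ i ∈ Finset.range N, (1 + t * x i)) ^ m := by
  induction m with
  | zero =>
    rw [Finset.sum_eq_single ∅]
    · simp [branchQ, branchP_empty]
    · intro B _ h
      simp [branchQ, h]
    · simp
  | succ m ih =>
    set Φ := branchP L (fun i => t * x i) N with hΦ
    set U := ∏ i ∈ Finset.range N, (1 - t * x i)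
    set V := ∏ i ∈ Finset.range N, (1 + t * x i)
    have h1 : (∑ A ∈ (Finset.range L).powerset, branchQ R L (m + 1) A * Φ A) =
        ∑ B ∈ (Finset.range L).powerset, branchQ R L m B *
          ∑ A ∈ (Finset.range L).powerset, stripWeight 2 1 B A L 0 * Φ A := by
      simp only [branchQ, Finset.sum_mul, Finset.mul_sum]
      rw [Finset.sum_comm]
      exact Finset.sum_congr rfl fun β _ => Finset.sum_congr rfl fun μ _ => by ring
    have h2 : U ^ (m + 1) * (∑ A ∈ (Finset.range L).powerset, branchQ R L (m + 1) A * Φ A) -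
        V ^ (m + 1) = U ^ m * (∑ B ∈ (Finset.range L).powerset, branchQ R L m B *
          (U * (∑ A ∈ (Finset.range L).powerset, stripWeight 2 1 B A L 0 * Φ A) - V * Φ B)) +
        V * (U ^ m * (∑ A ∈ (Finset.range L).powerset, branchQ R L m A * Φ A) - V ^ m) := by
      have h3 : (∑ B ∈ (Finset.range L).powerset, branchQ R L m B *
          (U * (∑ A ∈ (Finset.range L).powerset, stripWeight 2 1 B A L 0 * Φ A) - V * Φ B)) =
          U * (∑ A ∈ (Finset.range L).powerset, branchQ R L (m + 1) A * Φ A) -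
          V * (∑ A ∈ (Finset.range L).powerset, branchQ R L m A * Φ A) := by
        rw [h1, Finset.mul_sum, Finset.mul_sum, ← Finset.sum_sub_distrib]
        exact Finset.sum_congr rfl fun ν _ => by ring
      rw [h3]
      ring
    rw [h2]
    exact dvd_add (Dvd.dvd.mul_left (Finset.dvd_sum fun B hB => Dvd.dvd.mul_left
      (pow_dvd_sum_stripWeight_mul_branchP L t x N (Finset.mem_powerset.1 hB)) _) _)
      (Dvd.dvd.mul_left ih _)

/-- The Cauchy identity for Schur `P`-functions, with the second alphabet specialized to
`1, …, 1`. -/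
theorem coeff_cauchy (n N m : ℕ) (x : ℕ → R) (H : PowerSeries R)
    (hH : (∏ i ∈ Finset.range N, (1 - PowerSeries.X * PowerSeries.C (x i))) ^ m * H =
      (∏ i ∈ Finset.range N, (1 + PowerSeries.X * PowerSeries.C (x i))) ^ m) :
    PowerSeries.coeff n H = ∑ A ∈ (Finset.range n).powerset with size A = n,
      2 ^ A.card * branchP n (fun _ => (1 : R)) m A * branchP n x N A := by
  set U := ∏ i ∈ Finset.range N, (1 - PowerSeries.X * PowerSeries.C (x i)) with hU
  -- The constant term is 1, so the denominator can be cancelled in the divisibility. With `L = n`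
  -- the error starts in degree `n + 1` and does not reach the coefficient of degree `n`.
  have hunit : IsUnit (U ^ m) := by
    rw [PowerSeries.isUnit_iff_constantCoeff]
    simp [hU, map_prod]
  have h := pow_dvd_cauchy n (PowerSeries.X : PowerSeries R) (fun i => PowerSeries.C (x i)) N m
  rw [← hU, ← hH, ← mul_sub] at h
  have h' := (hunit.dvd_mul_left).1 h
  rw [PowerSeries.X_pow_dvd_iff] at h'
  have h'' := h' n (Nat.lt_succ_self n)
  rw [map_sub, sub_eq_zero, map_sum] at h''
  rw [← h'', Finset.sum_filter]
  refine Finset.sum_congr rfl fun A hA => ?_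
  rw [Finset.mem_powerset] at hA
  rw [branchQ_eq n m hA, branchP_homogeneous _ _ _ _ hA, ← map_branchP]
  have h1 : branchP n (fun _ => (1 : PowerSeries R)) m A =
      PowerSeries.C (branchP n (fun _ => (1 : R)) m A) := by
    rw [map_branchP]; simp
  have h2 : (2 : PowerSeries R) ^ A.card * PowerSeries.C (branchP n (fun _ => (1 : R)) m A) *
      (PowerSeries.X ^ size A * PowerSeries.C (branchP n x N A)) =
      PowerSeries.C (2 ^ A.card * branchP n (fun _ => (1 : R)) m A * branchP n x N A) *
        PowerSeries.X ^ size A := by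
    simp only [map_mul, map_pow, map_ofNat]
    ring
  rw [h1, h2, PowerSeries.coeff_C_mul, PowerSeries.coeff_X_pow]
  simp [eq_comm]

end ShiftedParking

end

noncomputable section

namespace ShiftedParking

variable {R : Type*} [CommRing R]

/-! ### Horizontal and vertical strips -/

/-- The number of cells of content `p` in the shape encoded by `A`. -/
def diagLen (A : Finset ℕ) (p : ℕ) : ℕ := (A.filter (p ≤ ·)).card

theorem diagLen_eq (A : Finset ℕ) (p : ℕ) :
    diagLen A p = diagLen A (p + 1) + if p ∈ A then 1 else 0 := by
  have h : A.filter (p ≤ ·) = A.filter (p + 1 ≤ ·) ∪ A.filter (p = ·) := by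
    ext a
    simp only [Finset.mem_filter, Finset.mem_union]
    grind
  rw [diagLen, diagLen, h, Finset.card_union_of_disjoint, Finset.filter_eq]
  · split_ifs <;> rfl
  · rw [Finset.disjoint_filter]
    intro a _ h1 h2
    omega

theorem diagLen_of_le {A : Finset ℕ} {L p : ℕ} (hA : A ⊆ Finset.range L) (hp : L ≤ p) :
    diagLen A p = 0 := by
  rw [diagLen, Finset.card_eq_zero, Finset.filter_eq_empty_iff]
  intro a ha
  have := Finset.mem_range.1 (hA ha)
  omega

theorem mem_iff_diagLen (A : Finset ℕ) (p : ℕ) : p ∈ A ↔ diagLen A p = diagLen A (p + 1) + 1 := by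
  rw [diagLen_eq A p]
  split_ifs with h <;> simp [h]

theorem diagLen_injective : Function.Injective diagLen := fun A B h => by
  ext p
  rw [mem_iff_diagLen, mem_iff_diagLen, h]

theorem diagLen_succ_le (A : Finset ℕ) (p : ℕ) : diagLen A (p + 1) ≤ diagLen A p := by
  rw [diagLen_eq A p]; omega

theorem diagLen_le_succ (A : Finset ℕ) (p : ℕ) : diagLen A p ≤ diagLen A (p + 1) + 1 := by
  rw [diagLen_eq A p]; split_ifs <;> omega

/-- A sequence is the list of diagonal lengths of a strict shape as soon as it vanishes eventually
and drops by 0 or 1 at each step; the shape consists of the places of the drops. -/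
theorem exists_diagLen_eq {L : ℕ} (c : ℕ → ℕ) (h0 : ∀ p, L ≤ p → c p = 0)
    (h1 : ∀ p, c (p + 1) ≤ c p) (h2 : ∀ p, c p ≤ c (p + 1) + 1) :
    ∃ B ⊆ Finset.range L, ∀ p, diagLen B p = c p := by
  refine ⟨(Finset.range L).filter fun p => c p ≠ c (p + 1), Finset.filter_subset _ _, ?_⟩
  have key : ∀ k p, L ≤ p + k →
      diagLen ((Finset.range L).filter fun p => c p ≠ c (p + 1)) p = c p := by
    intro k
    induction k with
    | zero =>
      intro p hp
      rw [add_zero] at hp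
      rw [h0 p hp, diagLen_of_le (Finset.filter_subset _ _) hp]
    | succ k ih =>
      intro p hp
      rw [diagLen_eq, ih (p + 1) (by omega)]
      have := h1 p
      have := h2 p
      simp only [Finset.mem_filter, Finset.mem_range]
      by_cases hL : p < L
      · split_ifs with h <;> omega
      · rw [if_neg (by omega), h0 p (by omega), h0 (p + 1) (by omega)]
  exact fun p => key L p (by omega)

/-- The edge bit above position `p - 1` of the strip `A / B`, if the edge bit above position
`L - 1` is `e`. -/
def edge (B A : Finset ℕ) (L : ℕ) (e : ℤ) (p : ℕ) : ℤ :=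
  e + ∑ q ∈ Finset.Ico p L, (bit A q - bit B q)

theorem edge_self (B A : Finset ℕ) (L : ℕ) (e : ℤ) : edge B A L e L = e := by simp [edge]

theorem edge_succ (B A : Finset ℕ) (L : ℕ) (e : ℤ) {p : ℕ} (hp : p ≤ L) :
    edge B A (L + 1) e p = edge B A L (e + bit A L - bit B L) p := by
  rw [edge, edge, Finset.sum_Ico_succ_top hp]; ring

theorem edge_congr {B B' A A' : Finset ℕ} {L : ℕ} (hB : ∀ p < L, p ∈ B ↔ p ∈ B')
    (hA : ∀ p < L, p ∈ A ↔ p ∈ A') (e : ℤ) (p : ℕ) : edge B A L e p = edge B' A' L e p := by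
  rw [edge, edge]
  congr 1
  refine Finset.sum_congr rfl fun q hq => ?_
  rw [Finset.mem_Ico] at hq
  rw [bit_congr hA hq.2, bit_congr hB hq.2]

theorem diagLen_eq_sum {A : Finset ℕ} {L : ℕ} (hA : A ⊆ Finset.range L) (p : ℕ) :
    (diagLen A p : ℤ) = ∑ q ∈ Finset.Ico p L, bit A q := by
  simp only [bit, diagLen]
  rw [Finset.sum_boole]
  congr 2
  ext a
  simp only [Finset.mem_filter, Finset.mem_Ico]
  have : a ∈ A → a < L := fun h => Finset.mem_range.1 (hA h)
  tauto

theorem edge_eq_diagLen {B A : Finset ℕ} {L : ℕ} (hB : B ⊆ Finset.range L)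
    (hA : A ⊆ Finset.range L) (p : ℕ) : edge B A L 0 p = (diagLen A p : ℤ) - diagLen B p := by
  rw [edge, Finset.sum_sub_distrib, diagLen_eq_sum hA, diagLen_eq_sum hB, zero_add]

open Classical in
/-- The weight of the part in positions below `L` of the vertical strip `A / B`, which has no cell
on the diagonal. -/
def vertWeight (x : R) (B A : Finset ℕ) (L : ℕ) (e : ℤ) : R :=
  if edge B A L e 0 = 0 ∧
      ∀ p < L, edge B A L e (p + 1) = 0 ∨ (edge B A L e (p + 1) = 1 ∧ p ∈ B) then
    ∏ p ∈ Finset.range L, if edge B A L e (p + 1) = 1 then x else 1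
  else 0

open Classical in
/-- The weight of the part in positions below `L` of the horizontal strip `A / B`. -/
def horizWeight (x : R) (B A : Finset ℕ) (L : ℕ) (e : ℤ) : R :=
  if (e = 0 ∨ e = 1) ∧ ∀ p < L, edge B A L e p = 0 ∨ (edge B A L e p = 1 ∧ p ∉ B) then
    ∏ p ∈ Finset.range (L + 1), if edge B A L e p = 1 then x else 1
  else 0

theorem vertWeight_succ (x : R) (B A : Finset ℕ) (L : ℕ) (e : ℤ) :
    vertWeight x B A (L + 1) e = (if e = 0 then 1 else if e = 1 ∧ L ∈ B then x else 0) *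
      vertWeight x B A L (e + bit A L - bit B L) := by
  classical
  have hc : (edge B A (L + 1) e 0 = 0 ∧ ∀ p < L + 1,
      edge B A (L + 1) e (p + 1) = 0 ∨ (edge B A (L + 1) e (p + 1) = 1 ∧ p ∈ B)) ↔
      (e = 0 ∨ (e = 1 ∧ L ∈ B)) ∧ (edge B A L (e + bit A L - bit B L) 0 = 0 ∧ ∀ p < L,
        edge B A L (e + bit A L - bit B L) (p + 1) = 0 ∨
          (edge B A L (e + bit A L - bit B L) (p + 1) = 1 ∧ p ∈ B)) := by
    rw [edge_succ _ _ _ _ (Nat.zero_le L)]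
    constructor
    · rintro ⟨h0, h⟩
      refine ⟨by simpa [edge_self] using h L (Nat.lt_succ_self L), h0, fun p hp => ?_⟩
      rw [← edge_succ _ _ _ _ (by omega)]
      exact h p (by omega)
    · rintro ⟨he, h0, h⟩
      refine ⟨h0, fun p hp => ?_⟩
      rcases Nat.lt_succ_iff_lt_or_eq.1 hp with hp | rfl
      · rw [edge_succ _ _ _ _ (by omega)]
        exact h p hp
      · rwa [edge_self]
  have hp : (∏ p ∈ Finset.range (L + 1), if edge B A (L + 1) e (p + 1) = 1 then x else 1) =
      (∏ p ∈ Finset.range L, if edge B A L (e + bit A L - bit B L) (p + 1) = 1 then x else 1) *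
        if e = 1 then x else 1 := by
    rw [Finset.prod_range_succ, edge_self]
    congr 1
    refine Finset.prod_congr rfl fun p hp => ?_
    rw [edge_succ _ _ _ _ (by simpa using hp)]
  rw [vertWeight, hp, vertWeight]
  simp only [hc]
  by_cases h0 : e = 0
  · simp [h0]
  · by_cases h1 : e = 1
    · by_cases hL : L ∈ B <;> simp [h1, hL, mul_comm]
    · simp [h0, h1]

/-- The condition at position `L` concerns the cell of content `L`, whose edge bit is the updated
one; for vertical strips it concerns the cell of content `L + 1`, with the old bit. -/
theorem horizWeight_succ (x : R) (B A : Finset ℕ) (L : ℕ) (e : ℤ) :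
    horizWeight x B A (L + 1) e = (if e = 0 then 1 else if e = 1 then x else 0) *
      (if e + bit A L - bit B L = 1 ∧ L ∈ B then 0 else 1) *
      horizWeight x B A L (e + bit A L - bit B L) := by
  classical
  have hc : ((e = 0 ∨ e = 1) ∧ ∀ p < L + 1,
      edge B A (L + 1) e p = 0 ∨ (edge B A (L + 1) e p = 1 ∧ p ∉ B)) ↔
      (e = 0 ∨ e = 1) ∧ ¬ (e + bit A L - bit B L = 1 ∧ L ∈ B) ∧
        ((e + bit A L - bit B L = 0 ∨ e + bit A L - bit B L = 1) ∧ ∀ p < L,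
          edge B A L (e + bit A L - bit B L) p = 0 ∨
            (edge B A L (e + bit A L - bit B L) p = 1 ∧ p ∉ B)) := by
    constructor
    · rintro ⟨h0, h⟩
      have := h L (Nat.lt_succ_self L)
      rw [edge_succ _ _ _ _ le_rfl, edge_self] at this
      refine ⟨h0, fun h' => this.elim (fun h2 => by omega) fun h2 => h2.2 h'.2,
        by tauto, fun p hp => ?_⟩
      rw [← edge_succ _ _ _ _ (by omega)]
      exact h p (by omega)
    · rintro ⟨he, h0, h1, h⟩
      refine ⟨he, fun p hp => ?_⟩
      rw [edge_succ _ _ _ _ (by omega)]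
      rcases Nat.lt_succ_iff_lt_or_eq.1 hp with hp | rfl
      · exact h p hp
      · rw [edge_self]; tauto
  have hp : (∏ p ∈ Finset.range (L + 1 + 1), if edge B A (L + 1) e p = 1 then x else 1) =
      (∏ p ∈ Finset.range (L + 1), if edge B A L (e + bit A L - bit B L) p = 1 then x else 1) *
        if e = 1 then x else 1 := by
    rw [Finset.prod_range_succ, edge_self]
    congr 1
    refine Finset.prod_congr rfl fun p hp => ?_
    rw [edge_succ _ _ _ _ (Nat.lt_succ_iff.1 (by simpa using hp))]
  rw [horizWeight, hp, horizWeight]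
  simp only [hc]
  generalize e + bit A L - bit B L = e'
  by_cases hQ : (e' = 0 ∨ e' = 1) ∧ ∀ p < L, edge B A L e' p = 0 ∨ (edge B A L e' p = 1 ∧ p ∉ B)
  · by_cases hL : e' = 1 ∧ L ∈ B
    · rw [if_neg (fun h => h.2.1 hL), if_pos hL]; simp
    · rw [if_neg hL, if_pos hQ, mul_one]
      by_cases h0 : e = 0
      · rw [if_pos ⟨Or.inl h0, hL, hQ⟩]; simp [h0]
      · by_cases h1 : e = 1
        · rw [if_pos ⟨Or.inr h1, hL, hQ⟩]; simp [h1, mul_comm]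
        · simp [h0, h1]
  · rw [if_neg (fun h => hQ h.2.2), if_neg hQ, mul_zero]

theorem vertWeight_zero (x : R) (B A : Finset ℕ) (e : ℤ) :
    vertWeight x B A 0 e = if e = 0 then 1 else 0 := by
  simp [vertWeight, edge]

theorem horizWeight_zero (x : R) (B A : Finset ℕ) (e : ℤ) :
    horizWeight x B A 0 e = if e = 0 then 1 else if e = 1 then x else 0 := by
  by_cases h0 : e = 0
  · simp [horizWeight, edge, h0]
  · by_cases h1 : e = 1 <;> simp [horizWeight, edge, h0, h1]

theorem vertWeight_eq_zero (x : R) (B A : Finset ℕ) (L : ℕ) {e : ℤ} (h0 : e ≠ 0) (h1 : e ≠ 1) :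
    vertWeight x B A L e = 0 := by
  cases L <;> simp [vertWeight_succ, vertWeight_zero, h0, h1]

theorem horizWeight_eq_zero (x : R) (B A : Finset ℕ) (L : ℕ) {e : ℤ} (h0 : e ≠ 0) (h1 : e ≠ 1) :
    horizWeight x B A L e = 0 := by
  simp [horizWeight, h0, h1]

theorem vertWeight_insert_right (x : R) (B A : Finset ℕ) (L : ℕ) (e : ℤ) :
    vertWeight x B (insert L A) L e = vertWeight x B A L e := by
  simp only [vertWeight, edge_congr (B := B) (fun _ _ => Iff.rfl)
    (fun _ hp => mem_insert_of_lt (A := A) hp)]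

theorem horizWeight_insert_left (x : R) (B A : Finset ℕ) (L : ℕ) (e : ℤ) :
    horizWeight x (insert L B) A L e = horizWeight x B A L e := by
  have h : (∀ p < L, edge B A L e p = 0 ∨ (edge B A L e p = 1 ∧ p ∉ insert L B)) ↔
      ∀ p < L, edge B A L e p = 0 ∨ (edge B A L e p = 1 ∧ p ∉ B) :=
    forall₂_congr fun p hp => by rw [mem_insert_of_lt hp]
  simp only [horizWeight, edge_congr (A := A) (fun _ hp => mem_insert_of_lt (A := B) hp)
    (fun _ _ => Iff.rfl), h]

/-! ### Marked strips: a vertical strip followed by a horizontal one -/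

/-- The sum over the ways to add first a vertical and then a horizontal strip. -/
def markedSum (x : R) (B A : Finset ℕ) (L : ℕ) (v h : ℤ) : R :=
  ∑ C ∈ (Finset.range L).powerset, vertWeight x B C L v * horizWeight x C A L h

theorem markedSum_eq_zero (x : R) (B A : Finset ℕ) (L : ℕ) {v h : ℤ}
    (hvh : (v ≠ 0 ∧ v ≠ 1) ∨ (h ≠ 0 ∧ h ≠ 1)) : markedSum x B A L v h = 0 := by
  refine Finset.sum_eq_zero fun C _ => ?_
  rcases hvh with h | h
  · rw [vertWeight_eq_zero _ _ _ _ h.1 h.2, zero_mul]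
  · rw [horizWeight_eq_zero _ _ _ _ h.1 h.2, mul_zero]

/-- The two summands correspond to whether `L` belongs to the intermediate shape `C`. In the second,
the factor that excludes a horizontal cell at content `L` prevents both bits from becoming 1 when `v
= 0`, `h = 1`. -/
theorem markedSum_succ (x : R) (B A : Finset ℕ) (L : ℕ) (v h : ℤ) :
    markedSum x B A (L + 1) v h =
      (if v = 0 then 1 else if v = 1 ∧ L ∈ B then x else 0) *
        (if h = 0 then 1 else if h = 1 then x else 0) *
        (markedSum x B A L (v - bit B L) (h + bit A L) +
          (if h + bit A L - 1 = 1 then 0 else 1) *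
          markedSum x B A L (v + 1 - bit B L) (h + bit A L - 1)) := by
  rw [mul_add]
  simp only [markedSum, sum_powerset_range_succ, Finset.sum_add_distrib, Finset.mul_sum]
  congr 1
  · refine Finset.sum_congr rfl fun C hC => ?_
    have hL := notMem_of_mem_powerset_range hC
    have hb : bit C L = 0 := by simp [bit, hL]
    simp only [vertWeight_succ, horizWeight_succ, hL, and_false, if_false, hb, add_zero, sub_zero]
    ring
  · refine Finset.sum_congr rfl fun C hC => ?_
    have hb : bit (insert L C) L = 1 := by simp [bit]
    simp only [vertWeight_succ, horizWeight_succ, Finset.mem_insert_self, and_true, hb,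
      vertWeight_insert_right, horizWeight_insert_left]
    ring

/-- A cell with a left neighbour in the strip must be unmarked, and one with a neighbour below it
must be marked. Only the cell of lowest content in each component is free, which gives the factor
`2`; on the main diagonal it must be unmarked, which gives `z = 1`. An edge bit 1 splits into the
states marked and unmarked. -/
theorem stripWeight_one_eq_markedSum (x : R) (B A : Finset ℕ) (L : ℕ) :
    stripWeight 1 x B A L 0 = markedSum x B A L 0 0 ∧
      stripWeight 1 x B A L 1 = markedSum x B A L 1 0 + markedSum x B A L 0 1 := by
  induction L with
  | zero =>
    simp [stripWeight, markedSum, vertWeight_zero, horizWeight_zero]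
  | succ L ih =>
    obtain ⟨h0, h1⟩ := ih
    have u (v h : ℤ) (hh : (v ≠ 0 ∧ v ≠ 1) ∨ (h ≠ 0 ∧ h ≠ 1)) := markedSum_eq_zero x B A L hh
    have u1 := fun f => u (-1) f (by norm_num)
    have u2 := fun f => u 2 f (by norm_num)
    have u3 := fun e => u e (-1) (by norm_num)
    have u4 := fun e => u e 2 (by norm_num)
    have s1 := stripWeight_eq_zero (1 : R) x B A L (e := -1) (by norm_num) (by norm_num)
    have s2 := stripWeight_eq_zero (1 : R) x B A L (e := 2) (by norm_num) (by norm_num)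
    by_cases hA : L ∈ A <;> by_cases hB : L ∈ B <;>
      simp only [markedSum_succ, stripWeight, bit, hA, hB, if_true, if_false] <;>
      norm_num [u1, u2, u3, u4, h0, h1, s1, s2] <;> ring

end ShiftedParking

end

noncomputable section

namespace ShiftedParking

variable {R : Type*} [CommRing R]

/-! ### Tableaux as chains of strips -/

/-- The tableaux of shape `A` whose letters are the first `M` letters of the alphabet: `T i p` is
the index of the letter in row `i` on the diagonal of content `p`, and `M` outside of the shape.
The odd indices belong to the unmarked letters. -/
structure IsTab (M : ℕ) (A : Finset ℕ) (T : ℕ → ℕ → ℕ) : Prop where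
  le : ∀ i p, T i p ≤ M
  lt_iff : ∀ i p, T i p < M ↔ i < diagLen A p
  row_le : ∀ i p, T i p ≤ T i (p + 1)
  col_le : ∀ i p, T i (p + 1) ≤ T (i + 1) p
  row_odd : ∀ i p, T i p < M → T i p = T i (p + 1) → T i p % 2 = 1
  col_even : ∀ i p, T i (p + 1) < M → T i (p + 1) = T (i + 1) p → T i (p + 1) % 2 = 0
  diag_odd : ∀ i, T i 0 < M → T i 0 % 2 = 1

/-- The type of tableaux of shape `A` in the first `M` letters. -/
def Tab (M : ℕ) (A : Finset ℕ) : Type := {T : ℕ → ℕ → ℕ // IsTab M A T}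

/-- The cells of `A` not in `B` can be filled with the letter of index `M`. -/
structure IsStrip (M : ℕ) (B A : Finset ℕ) : Prop where
  le : ∀ p, diagLen B p ≤ diagLen A p
  row : M % 2 = 0 → ∀ p, diagLen A (p + 1) ≤ diagLen B p
  col : M % 2 = 1 → ∀ p, diagLen A p ≤ diagLen B (p + 1) + 1
  diag : M % 2 = 0 → diagLen A 0 ≤ diagLen B 0

/-- Add the letter of index `M` in the cells of `A` not yet filled. -/
def extend (M : ℕ) (A : Finset ℕ) (T : ℕ → ℕ → ℕ) (i p : ℕ) : ℕ :=
  if T i p < M then T i p else if i < diagLen A p then M else M + 1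

theorem IsTab.extend {M : ℕ} {B A : Finset ℕ} {T : ℕ → ℕ → ℕ} (hT : IsTab M B T)
    (h : IsStrip M B A) : IsTab (M + 1) A (extend M A T) := by
  have hc (i p) : T i p < M → i < diagLen A p := fun h' =>
    ((hT.lt_iff i p).1 h').trans_le (h.le p)
  have h1 := hT.lt_iff
  have h2 := diagLen_succ_le A
  have h3 := diagLen_le_succ A
  have h4 := hT.row_le
  have h5 := hT.col_le
  refine ⟨?_, ?_, ?_, ?_, ?_, ?_, ?_⟩
  · intro i p
    unfold ShiftedParking.extend
    split_ifs <;> omega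
  · intro i p
    have := hc i p
    unfold ShiftedParking.extend
    split_ifs <;> grind
  · intro i p
    have := hc i p; have := hc i (p + 1); have := h2 p; have := h4 i p
    unfold ShiftedParking.extend
    split_ifs <;> grind
  · intro i p
    have := hc i (p + 1); have := hc (i + 1) p; have := h3 p; have := h5 i p
    unfold ShiftedParking.extend
    split_ifs <;> grind
  · intro i p
    have := hc i p; have := hc i (p + 1); have := h2 p; have := h4 i p
    have := h1 i p; have := h1 i (p + 1)
    have := hT.row_odd i p
    have := fun h' => h.row h' p
    unfold ShiftedParking.extend
    split_ifs <;> grind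
  · intro i p
    have := hc i (p + 1); have := hc (i + 1) p; have := h3 p; have := h5 i p
    have := h1 i (p + 1); have := h1 (i + 1) p
    have := hT.col_even i p
    have := fun h' => h.col h' p
    unfold ShiftedParking.extend
    split_ifs <;> grind
  · intro i
    have := hc i 0
    have := h1 i 0
    have := hT.diag_odd i
    have := h.diag
    unfold ShiftedParking.extend
    split_ifs <;> grind

theorem IsTab.min_extend {M : ℕ} {B A : Finset ℕ} {T : ℕ → ℕ → ℕ} (hT : IsTab M B T) (i p : ℕ) :
    min (ShiftedParking.extend M A T i p) M = T i p := by
  have := hT.le i p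
  unfold ShiftedParking.extend
  split_ifs <;> omega

theorem IsTab.shape_unique {M : ℕ} {B B' : Finset ℕ} {T : ℕ → ℕ → ℕ} (h : IsTab M B T)
    (h' : IsTab M B' T) : B = B' := by
  apply diagLen_injective
  funext p
  refine le_antisymm ?_ ?_
  · by_contra hlt
    exact lt_irrefl _ ((h'.lt_iff _ _).1 ((h.lt_iff _ p).2 (not_le.1 hlt)))
  · by_contra hlt
    exact lt_irrefl _ ((h.lt_iff _ _).1 ((h'.lt_iff _ p).2 (not_le.1 hlt)))

/-- A step down a diagonal is a step to the right followed by a step down. -/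
theorem IsTab.monotone {M : ℕ} {A : Finset ℕ} {T : ℕ → ℕ → ℕ} (hT : IsTab M A T) (p : ℕ) :
    Monotone fun i => T i p :=
  monotone_nat_of_le_succ fun i => (hT.row_le i p).trans (hT.col_le i p)

theorem exists_lt_iff_of_monotone {f : ℕ → ℕ} (hf : Monotone f) {M : ℕ} (h : ∃ i, M ≤ f i) :
    ∃ c, ∀ i, f i < M ↔ i < c := by
  refine ⟨Nat.find h, fun i => ⟨fun hi => ?_, fun hi => not_le.1 (Nat.find_min h hi)⟩⟩
  by_contra hlt
  exact absurd hi (not_lt.2 ((Nat.find_spec h).trans (hf (not_lt.1 hlt))))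

/-- On each diagonal the cells with letters below `M` form an initial segment, by monotonicity. The
row and column inequalities make the lengths of these segments drop by 0 or 1, so they come from a
strict shape. A violation of a strip condition would give two adjacent cells, or a diagonal cell,
with a forbidden letter `M`. -/
theorem IsTab.exists_restrict {M L : ℕ} {A : Finset ℕ} (hA : A ⊆ Finset.range L)
    {T : ℕ → ℕ → ℕ} (hT : IsTab (M + 1) A T) :
    ∃ B ⊆ Finset.range L, IsStrip M B A ∧ IsTab M B fun i p => min (T i p) M := by
  have hex (p : ℕ) : ∃ c, ∀ i, T i p < M ↔ i < c := by
    refine exists_lt_iff_of_monotone (hT.monotone p) ⟨diagLen A p, ?_⟩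
    have := (hT.lt_iff (diagLen A p) p).not.2 (lt_irrefl _)
    omega
  choose c hc using hex
  have hcA (p : ℕ) : c p ≤ diagLen A p := by
    by_contra hlt
    have h1 := (hc p (diagLen A p)).2 (not_le.1 hlt)
    exact lt_irrefl _ ((hT.lt_iff (diagLen A p) p).1 (by omega))
  have hc1 (p : ℕ) : c (p + 1) ≤ c p := by
    by_contra hlt
    have h1 := (hc (p + 1) (c p)).2 (not_le.1 hlt)
    exact lt_irrefl _ ((hc p (c p)).1 ((hT.row_le _ _).trans_lt h1))
  have hc2 (p : ℕ) : c p ≤ c (p + 1) + 1 := by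
    by_contra hlt
    have h1 := (hc p (c (p + 1) + 1)).2 (not_le.1 hlt)
    exact lt_irrefl _ ((hc (p + 1) (c (p + 1))).1 ((hT.col_le _ _).trans_lt h1))
  obtain ⟨B, hBL, hB⟩ := exists_diagLen_eq (L := L) c
    (fun p hp => Nat.le_zero.1 ((hcA p).trans (diagLen_of_le hA hp).le)) hc1 hc2
  have hM (i p : ℕ) (h1 : i < diagLen A p) (h2 : c p ≤ i) : T i p = M := by
    have := (hT.lt_iff i p).2 h1
    have := (hc p i).not.2 (not_lt.2 h2)
    omega
  refine ⟨B, hBL, ⟨?_, ?_, ?_, ?_⟩, ⟨?_, ?_, ?_, ?_, ?_, ?_, ?_⟩⟩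
  · exact fun p => (hB p).trans_le (hcA p)
  · intro hpar p
    rw [hB]
    by_contra hlt
    rw [not_le] at hlt
    have e1 := hM (c p) (p + 1) hlt (hc1 p)
    have e2 := hM (c p) p (hlt.trans_le (diagLen_succ_le A p)) le_rfl
    have := hT.row_odd (c p) p (by omega) (by omega)
    omega
  · intro hpar p
    rw [hB]
    by_contra hlt
    rw [not_le] at hlt
    have := diagLen_le_succ A p
    have e1 := hM (c (p + 1)) (p + 1) (by omega) le_rfl
    have e2 := hM (c (p + 1) + 1) p hlt (hc2 p)
    have := hT.col_even (c (p + 1)) p (by omega) (by omega)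
    omega
  · intro hpar
    rw [hB]
    by_contra hlt
    rw [not_le] at hlt
    have e1 := hM (c 0) 0 hlt le_rfl
    have := hT.diag_odd (c 0) (by omega)
    omega
  · exact fun i p => min_le_right _ _
  · intro i p
    rw [hB, ← hc]
    omega
  · intro i p
    have := hT.row_le i p
    omega
  · intro i p
    have := hT.col_le i p
    omega
  · intro i p h1 h2
    have := hT.row_odd i p
    omega
  · intro i p h1 h2
    have := hT.col_even i p
    omega
  · intro i h1
    have := hT.diag_odd i
    omega

theorem IsTab.extend_restrict {M : ℕ} {A : Finset ℕ} {T : ℕ → ℕ → ℕ} (hT : IsTab (M + 1) A T) :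
    ShiftedParking.extend M A (fun i p => min (T i p) M) = T := by
  funext i p
  have := hT.le i p
  have := hT.lt_iff i p
  unfold ShiftedParking.extend
  dsimp only
  split_ifs <;> omega

/-- Adding the cells filled with the last letter. -/
def tabExtend (M L : ℕ) (A : Finset ℕ)
    (T : Σ B : {B // B ⊆ Finset.range L ∧ IsStrip M B A}, Tab M B.1) : Tab (M + 1) A :=
  ⟨extend M A T.2.1, T.2.2.extend T.1.2.2⟩

/-- Truncating the entries at `M` undoes the extension, and the default value `M` outside the shape
lets the smaller tableau determine its own shape. -/
theorem tabExtend_bijective (M : ℕ) {L : ℕ} {A : Finset ℕ} (hA : A ⊆ Finset.range L) :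
    Function.Bijective (tabExtend M L A) := by
  constructor
  · rintro ⟨⟨B, hB⟩, T, hT⟩ ⟨⟨B', hB'⟩, T', hT'⟩ h
    have h1 : extend M A T = extend M A T' := congrArg Subtype.val h
    have h2 : T = T' := by
      funext i p
      rw [← hT.min_extend (A := A), ← hT'.min_extend (A := A), h1]
    subst h2
    obtain rfl := hT.shape_unique hT'
    rfl
  · rintro ⟨T, hT⟩
    obtain ⟨B, hBL, hB, hT'⟩ := hT.exists_restrict hA
    exact ⟨⟨⟨B, hBL, hB⟩, _, hT'⟩, Subtype.ext hT.extend_restrict⟩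

theorem isTab_zero_iff (A : Finset ℕ) (T : ℕ → ℕ → ℕ) :
    IsTab 0 A T ↔ A = ∅ ∧ T = fun _ _ => 0 := by
  constructor
  · intro h
    refine ⟨?_, ?_⟩
    · apply diagLen_injective
      funext p
      have := h.lt_iff 0 p
      simp [diagLen] at this ⊢
      omega
    · funext i p
      exact Nat.le_zero.1 (h.le i p)
  · rintro ⟨rfl, rfl⟩
    constructor <;> simp [diagLen]

theorem subset_range_sup (A : Finset ℕ) : A ⊆ Finset.range (A.sup id + 1) := fun _ ha =>
  Finset.mem_range.2 (Nat.lt_succ_of_le (Finset.le_sup (f := id) ha))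

instance (M : ℕ) (A : Finset ℕ) : Finite (Tab M A) := by
  induction M generalizing A with
  | zero =>
    have : Subsingleton (Tab 0 A) := ⟨fun T T' => Subtype.ext
      (((isTab_zero_iff A _).1 T.2).2.trans ((isTab_zero_iff A _).1 T'.2).2.symm)⟩
    infer_instance
  | succ M ih =>
    have hA := subset_range_sup A
    generalize A.sup id + 1 = L at hA
    have : Finite {B // B ⊆ Finset.range L ∧ IsStrip M B A} :=
      Set.Finite.subset (Finset.range L).powerset.finite_toSet fun _ hB =>
        Finset.mem_coe.2 (Finset.mem_powerset.2 hB.1)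
    exact Finite.of_surjective _ (tabExtend_bijective M hA).2

instance (M : ℕ) (A : Finset ℕ) : Fintype (Tab M A) := Fintype.ofFinite _

/-- The weight of a tableau. -/
def tabWeight (x : ℕ → R) (L M : ℕ) (A : Finset ℕ) (T : Tab M A) : R :=
  ∏ p ∈ Finset.range L, ∏ i ∈ Finset.range (diagLen A p), x (T.1 i p / 2)

theorem tabWeight_tabExtend (x : ℕ → R) (M : ℕ) {L : ℕ} {A : Finset ℕ}
    (T : Σ B : {B // B ⊆ Finset.range L ∧ IsStrip M B A}, Tab M B.1) :
    tabWeight x L (M + 1) A (tabExtend M L A T) =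
      (∏ p ∈ Finset.range L, x (M / 2) ^ (diagLen A p - diagLen T.1.1 p)) *
        tabWeight x L M T.1.1 T.2 := by
  obtain ⟨⟨B, hBL, hB⟩, T, hT⟩ := T
  simp only [tabWeight, tabExtend, ← Finset.prod_mul_distrib]
  refine Finset.prod_congr rfl fun p _ => ?_
  rw [← Finset.prod_range_mul_prod_Ico _ (hB.le p), mul_comm]
  congr 1
  · rw [← Nat.card_Ico, ← Finset.prod_const]
    refine Finset.prod_congr rfl fun i hi => ?_
    rw [Finset.mem_Ico] at hi
    rw [extend, if_neg ((hT.lt_iff _ _).not.2 (not_lt.2 hi.1)), if_pos hi.2]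
  · refine Finset.prod_congr rfl fun i hi => ?_
    rw [extend, if_pos (by rwa [hT.lt_iff, ← Finset.mem_range])]

/-- The generating function of the tableaux of shape `A` in the first `M` letters. -/
def tabSum (x : ℕ → R) (L M : ℕ) (A : Finset ℕ) : R := ∑ T : Tab M A, tabWeight x L M A T

open Classical in
theorem tabSum_succ (x : ℕ → R) (M : ℕ) {L : ℕ} {A : Finset ℕ} (hA : A ⊆ Finset.range L) :
    tabSum x L (M + 1) A = ∑ B ∈ (Finset.range L).powerset, (if IsStrip M B A then
      ∏ p ∈ Finset.range L, x (M / 2) ^ (diagLen A p - diagLen B p) else 0) * tabSum x L M B := by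
  have : Fintype {B // B ⊆ Finset.range L ∧ IsStrip M B A} :=
    Fintype.subtype ((Finset.range L).powerset.filter fun B => IsStrip M B A) (by simp)
  rw [tabSum, ← (tabExtend_bijective M hA).sum_comp, Fintype.sum_sigma]
  simp only [tabWeight_tabExtend, ← Finset.mul_sum]
  simp only [ite_mul, zero_mul]
  rw [← Finset.sum_filter]
  refine (Finset.sum_subtype _ (fun B => ?_) (fun B =>
    (∏ p ∈ Finset.range L, x (M / 2) ^ (diagLen A p - diagLen B p)) * tabSum x L M B)).symm
  simp

open Classical in
-- An even index is a marked letter. The left neighbour of a new cell of content `p + 1` must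
-- already lie in `B`, which means `p ∈ B`; on the main diagonal no new cell is allowed.
theorem vertWeight_eq_ite (x : R) {M L : ℕ} (hM : M % 2 = 0) {B A : Finset ℕ}
    (hB : B ⊆ Finset.range L) (hA : A ⊆ Finset.range L) :
    (if IsStrip M B A then ∏ p ∈ Finset.range L, x ^ (diagLen A p - diagLen B p) else 0) =
      vertWeight x B A L 0 := by
  have hAL := diagLen_of_le hA le_rfl
  have hBL := diagLen_of_le hB le_rfl
  simp only [vertWeight, edge_eq_diagLen hB hA]
  have hiff : IsStrip M B A ↔ ((diagLen A 0 : ℤ) - diagLen B 0 = 0 ∧ ∀ p < L,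
      (diagLen A (p + 1) : ℤ) - diagLen B (p + 1) = 0 ∨
        ((diagLen A (p + 1) : ℤ) - diagLen B (p + 1) = 1 ∧ p ∈ B)) := by
    simp only [mem_iff_diagLen]
    constructor
    · intro h
      refine ⟨?_, fun p _ => ?_⟩
      · have := h.diag hM
        have := h.le 0
        omega
      · have := h.le (p + 1)
        have := h.row hM p
        have := diagLen_le_succ B p
        omega
    · rintro ⟨h0, h⟩
      have h' : ∀ p, (diagLen A (p + 1) : ℤ) - diagLen B (p + 1) = 0 ∨
        ((diagLen A (p + 1) : ℤ) - diagLen B (p + 1) = 1 ∧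
          diagLen B p = diagLen B (p + 1) + 1) := by
        intro p
        by_cases hp : p < L
        · exact h p hp
        · rw [diagLen_of_le hA (by omega), diagLen_of_le hB (by omega)]
          simp
      refine ⟨fun p => ?_, fun _ p => ?_, fun h => by omega, fun _ => by omega⟩
      · cases p with
        | zero => omega
        | succ p => have := h' p; omega
      · have := h' p
        have := diagLen_succ_le B p
        omega
  simp only [← hiff]
  refine ite_congr rfl (fun h => ?_) (fun _ => rfl)
  have h0 : diagLen A 0 - diagLen B 0 = 0 := Nat.sub_eq_zero_of_le (h.diag hM)
  -- The factors at contents `0` and `L` are trivial, so the product may be shifted from `p` to `p +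
  -- 1`.
  have := Finset.prod_range_succ' (fun p => x ^ (diagLen A p - diagLen B p)) L
  rw [Finset.prod_range_succ, hAL, hBL, h0] at this
  rw [tsub_self, pow_zero, mul_one, mul_one] at this
  rw [this]
  refine Finset.prod_congr rfl fun p hp => ?_
  have h1 := h.le (p + 1)
  have h2 := h.row hM p
  have h3 := diagLen_le_succ B p
  split_ifs with h4
  · rw [show diagLen A (p + 1) - diagLen B (p + 1) = 1 by omega, pow_one]
  · rw [show diagLen A (p + 1) - diagLen B (p + 1) = 0 by omega, pow_zero]

open Classical in
-- An odd index is an unmarked letter. Unless it is in the first row, a new cell of content `p` must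
-- have its upper neighbour in `B`, which means `p ∉ B`.
theorem horizWeight_eq_ite (x : R) {M L : ℕ} (hM : M % 2 = 1) {B A : Finset ℕ}
    (hB : B ⊆ Finset.range L) (hA : A ⊆ Finset.range L) :
    (if IsStrip M B A then ∏ p ∈ Finset.range L, x ^ (diagLen A p - diagLen B p) else 0) =
      horizWeight x B A L 0 := by
  have hAL := diagLen_of_le hA le_rfl
  have hBL := diagLen_of_le hB le_rfl
  simp only [horizWeight, edge_eq_diagLen hB hA, true_or, true_and]
  have hiff : IsStrip M B A ↔ (∀ p < L, (diagLen A p : ℤ) - diagLen B p = 0 ∨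
        ((diagLen A p : ℤ) - diagLen B p = 1 ∧ p ∉ B)) := by
    simp only [mem_iff_diagLen]
    constructor
    · intro h p _
      have := h.le p
      have := h.col hM p
      have := diagLen_succ_le B p
      omega
    · intro h
      have h' : ∀ p, (diagLen A p : ℤ) - diagLen B p = 0 ∨
        ((diagLen A p : ℤ) - diagLen B p = 1 ∧ ¬ diagLen B p = diagLen B (p + 1) + 1) := by
        intro p
        by_cases hp : p < L
        · exact h p hp
        · rw [diagLen_of_le hA (by omega), diagLen_of_le hB (by omega)]
          simp
      refine ⟨fun p => ?_, fun h => by omega, fun _ p => ?_, fun h => by omega⟩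
      · have := h' p; omega
      · have := h' p
        have := diagLen_le_succ B p
        omega
  simp only [← hiff]
  refine ite_congr rfl (fun h => ?_) (fun _ => rfl)
  rw [Finset.prod_range_succ, hAL, hBL]
  simp only [sub_self, zero_ne_one, if_false, mul_one]
  refine Finset.prod_congr rfl fun p hp => ?_
  have h1 := h.le p
  have h2 := h.col hM p
  have h3 := diagLen_succ_le B p
  split_ifs with h4
  · rw [show diagLen A p - diagLen B p = 1 by omega, pow_one]
  · rw [show diagLen A p - diagLen B p = 0 by omega, pow_zero]

/-- The letters of indices `2N` and `2N + 1` are the two forms of the same variable; they are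
removed together, with the intermediate shape `C` summed out. -/
theorem tabSum_eq_branchP (x : ℕ → R) (N : ℕ) {L : ℕ} {A : Finset ℕ} (hA : A ⊆ Finset.range L) :
    tabSum x L (2 * N) A = branchP L x N A := by
  classical
  induction N generalizing A with
  | zero =>
    rw [branchP, tabSum]
    split_ifs with h
    · subst h
      have : Unique (Tab (2 * 0) ∅) :=
        { default := ⟨fun _ _ => 0, (isTab_zero_iff _ _).2 ⟨rfl, rfl⟩⟩
          uniq := fun T => Subtype.ext ((isTab_zero_iff _ _).1 T.2).2 }
      rw [Fintype.sum_unique, tabWeight]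
      simp [diagLen]
    · have : IsEmpty (Tab (2 * 0) A) := ⟨fun T => h ((isTab_zero_iff _ _).1 T.2).1⟩
      simp
  | succ N ih =>
    have e1 : (2 * N + 1) / 2 = N := by omega
    have e2 : 2 * N / 2 = N := by omega
    rw [show 2 * (N + 1) = 2 * N + 1 + 1 by ring, tabSum_succ _ _ hA, branchP, e1]
    have h1 : ∀ C ∈ (Finset.range L).powerset,
        (if IsStrip (2 * N + 1) C A then
          ∏ p ∈ Finset.range L, x N ^ (diagLen A p - diagLen C p) else 0) *
          tabSum x L (2 * N + 1) C =
        ∑ B ∈ (Finset.range L).powerset,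
          vertWeight (x N) B C L 0 * horizWeight (x N) C A L 0 * branchP L x N B := by
      intro C hC
      rw [Finset.mem_powerset] at hC
      rw [horizWeight_eq_ite _ (by omega) hC hA, tabSum_succ _ _ hC, e2, Finset.mul_sum]
      refine Finset.sum_congr rfl fun B hB => ?_
      rw [Finset.mem_powerset] at hB
      rw [vertWeight_eq_ite _ (by omega) hB hC, ih hB]
      ring
    rw [Finset.sum_congr rfl h1, Finset.sum_comm]
    refine Finset.sum_congr rfl fun B _ => ?_
    rw [← Finset.sum_mul, (stripWeight_one_eq_markedSum (x N) B A L).1, markedSum]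

end ShiftedParking

end

noncomputable section

namespace ShiftedParking

variable {R : Type*} [CommRing R]

/-! ### Comparison with marked shifted tableaux -/

/-- The finite set that encodes a strict partition. -/
def shape {n : ℕ} (lam : n.Partition) : Finset ℕ := lam.parts.toFinset.image fun a => a - 1

theorem mem_shape {n : ℕ} {lam : n.Partition} {a : ℕ} : a ∈ shape lam ↔ a + 1 ∈ lam.parts := by
  simp only [shape, Finset.mem_image, Multiset.mem_toFinset]
  constructor
  · rintro ⟨b, hb, rfl⟩
    rwa [Nat.sub_add_cancel (lam.parts_pos hb)]
  · exact fun h => ⟨a + 1, h, rfl⟩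

theorem sum_shape {M : Type*} [AddCommMonoid M] {n : ℕ} {lam : n.Partition}
    (h : lam ∈ Nat.Partition.distincts n) (f : ℕ → M) :
    ∑ a ∈ shape lam, f (a + 1) = (lam.parts.map f).sum := by
  have hnd : lam.parts.Nodup := (Finset.mem_filter.1 h).2
  rw [shape, Finset.sum_image, Finset.sum, Multiset.toFinset_val, hnd.dedup]
  · congr 1
    refine Multiset.map_congr rfl fun a ha => ?_
    rw [Nat.sub_add_cancel (lam.parts_pos ha)]
  · intro a ha b hb hab
    have := lam.parts_pos (Multiset.mem_toFinset.1 ha)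
    have := lam.parts_pos (Multiset.mem_toFinset.1 hb)
    simp only at hab
    omega

theorem size_shape {n : ℕ} {lam : n.Partition} (h : lam ∈ Nat.Partition.distincts n) :
    size (shape lam) = n := by
  rw [size, sum_shape h fun a => a]
  simp [lam.parts_sum]

theorem card_shape {n : ℕ} {lam : n.Partition} (h : lam ∈ Nat.Partition.distincts n) :
    (shape lam).card = lam.parts.card := by
  rw [Finset.card_eq_sum_ones, sum_shape h fun _ => 1]
  simp

theorem subset_range_of_size {A : Finset ℕ} {n : ℕ} (h : size A = n) : A ⊆ Finset.range n := by
  intro a ha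
  have : a + 1 ≤ size A := Finset.single_le_sum (f := fun a => a + 1) (by simp) ha
  rw [Finset.mem_range]
  omega

theorem sum_distincts {M : Type*} [AddCommMonoid M] (n : ℕ) (f : Finset ℕ → M) :
    ∑ lam ∈ Nat.Partition.distincts n, f (shape lam) =
      ∑ A ∈ (Finset.range n).powerset with size A = n, f A := by
  refine Finset.sum_bij (fun lam _ => shape lam) ?_ ?_ ?_ fun _ _ => rfl
  · intro lam h
    simp only [Finset.mem_filter, Finset.mem_powerset]
    exact ⟨subset_range_of_size (size_shape h), size_shape h⟩
  · intro lam h lam' h' heq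
    have hnd : lam.parts.Nodup := (Finset.mem_filter.1 h).2
    have hnd' : lam'.parts.Nodup := (Finset.mem_filter.1 h').2
    ext1
    rw [hnd.ext hnd']
    intro a
    rcases Nat.eq_zero_or_pos a with rfl | ha
    · exact ⟨fun h => absurd (lam.parts_pos h) (lt_irrefl 0),
        fun h => absurd (lam'.parts_pos h) (lt_irrefl 0)⟩
    · obtain ⟨b, rfl⟩ := Nat.exists_eq_add_of_le' ha
      rw [← mem_shape, ← mem_shape, heq]
  · intro A hA
    rw [Finset.mem_filter] at hA
    refine ⟨⟨A.val.map (· + 1), ?_, ?_⟩, ?_, ?_⟩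
    · intro i hi
      obtain ⟨a, -, rfl⟩ := Multiset.mem_map.1 hi
      exact Nat.succ_pos a
    · exact hA.2
    · rw [Nat.Partition.distincts, Finset.mem_filter]
      exact ⟨Finset.mem_univ _, A.nodup.map (add_left_injective 1)⟩
    · ext a
      rw [mem_shape]
      simp

theorem lt_getD_iff_of_pairwise (l : List ℕ) (hl : l.Pairwise (· ≥ ·)) (i p : ℕ) :
    p < l.getD i 0 ↔ i < l.countP (p < ·) := by
  induction l generalizing i with
  | nil => simp
  | cons a l ih =>
    rw [List.pairwise_cons] at hl
    by_cases ha : p < a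
    · rw [List.countP_cons_of_pos (by simpa using ha)]
      cases i with
      | zero => simpa using ha
      | succ i => simpa using ih hl.2 i
    · rw [List.countP_cons_of_neg (by simpa using ha)]
      have h0 : l.countP (p < ·) = 0 := by
        rw [List.countP_eq_zero]
        intro b hb
        have := hl.1 b hb
        simp only [decide_eq_true_eq]
        omega
      rw [h0]
      cases i with
      | zero => simpa using ha
      | succ i =>
        have := ih hl.2 i
        rw [h0] at this
        simpa using this

/-- Both sides compare the decreasing list of parts with its conjugate: row `i` reaches content `p`
exactly when more than `i` parts exceed `p`. -/
theorem lt_rowLen_iff {n : ℕ} {lam : n.Partition} (h : lam ∈ Nat.Partition.distincts n)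
    (i p : ℕ) : p < rowLen lam i ↔ i < diagLen (shape lam) p := by
  rw [rowLen, lt_getD_iff_of_pairwise _ (Multiset.pairwise_sort _ _)]
  have h1 : (lam.parts.sort (· ≥ ·)).countP (p < ·) = lam.parts.countP (p < ·) := by
    conv_rhs => rw [← Multiset.sort_eq lam.parts (· ≥ ·)]
    rw [Multiset.coe_countP]
  have h2 : diagLen (shape lam) p = lam.parts.countP (p < ·) := by
    rw [diagLen, Finset.card_filter]
    have := sum_shape h fun a => if p < a then 1 else 0
    simp only [Nat.lt_succ_iff] at this
    rw [this]
    induction lam.parts using Multiset.induction_on with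
    | empty => simp
    | cons a s ih =>
      rw [Multiset.map_cons, Multiset.sum_cons, Multiset.countP_cons, ih, add_comm]
  rw [h1, h2]

theorem mem_shiftedDiagram {n : ℕ} {lam : n.Partition} (h : lam ∈ Nat.Partition.distincts n)
    {i j : ℕ} : (i, j) ∈ shiftedDiagram lam ↔ i ≤ j ∧ i < diagLen (shape lam) (j - i) := by
  simp only [shiftedDiagram, Finset.mem_biUnion, Finset.mem_range, Finset.mem_product,
    Finset.mem_singleton, Finset.mem_Ico]
  rw [← lt_rowLen_iff h]
  constructor
  · rintro ⟨i, hi, rfl, h1, h2⟩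
    omega
  · rintro ⟨h1, h2⟩
    refine ⟨i, ?_, rfl, h1, by omega⟩
    by_contra hlt
    rw [rowLen, List.getD_eq_default _ _ (by simpa using hlt)] at h2
    omega

/-! ### Letters as indices, and the tableaux with bounded letters -/

/-- The index of a letter. -/
def Letter.index (a : Letter) : ℕ := 2 * a.abs + if (ofLex a).2 then 1 else 0

/-- The letter with a given index. -/
def Letter.ofIndex (k : ℕ) : Letter := toLex (k / 2, decide (k % 2 = 1))

theorem Letter.ofIndex_index (a : Letter) : Letter.ofIndex a.index = a := by
  obtain ⟨⟨k, b⟩, rfl⟩ := toLex.surjective a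
  simp only [ofIndex, index, abs, ofLex_toLex]
  congr 1
  cases b
  · simp
  · simp only [if_true, Prod.mk.injEq, decide_eq_true_eq]
    omega

theorem Letter.index_ofIndex (k : ℕ) : (Letter.ofIndex k).index = k := by
  simp only [ofIndex, index, abs, ofLex_toLex, decide_eq_true_eq]
  split_ifs <;> omega

theorem Letter.abs_eq_index_div (a : Letter) : a.abs = a.index / 2 := by
  rw [index]; split_ifs <;> omega

theorem Letter.marked_iff (a : Letter) : a.Marked ↔ a.index % 2 = 0 := by
  rw [Marked, index]
  cases h : (ofLex a).2 <;> simp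

theorem Letter.le_iff_index (a b : Letter) : a ≤ b ↔ a.index ≤ b.index := by
  rw [Prod.Lex.le_iff, index, index, abs, abs]
  cases ha : (ofLex a).2 <;> cases hb : (ofLex b).2 <;> simp <;> omega

theorem Letter.index_injective : Function.Injective Letter.index :=
  Function.LeftInverse.injective Letter.ofIndex_index

theorem MarkedShiftedTableau.ext_entry {n : ℕ} {lam : n.Partition}
    {T T' : MarkedShiftedTableau lam} (h : T.entry = T'.entry) : T = T' := by
  cases T; cases T'; cases h; rfl

open Classical in
/-- The indices of the letters of a marked shifted tableau, and `2 * N` outside of the shape. -/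
def MarkedShiftedTableau.toIndex {n : ℕ} {lam : n.Partition} (T : MarkedShiftedTableau lam)
    (N i p : ℕ) : ℕ :=
  if h : (i, i + p) ∈ shiftedDiagram lam then (T.entry ⟨(i, i + p), h⟩).index else 2 * N

theorem MarkedShiftedTableau.isTab_toIndex {n : ℕ} {lam : n.Partition}
    (h : lam ∈ Nat.Partition.distincts n) (T : MarkedShiftedTableau lam) {N : ℕ}
    (hT : ∀ c, (T.entry c).abs < N) : IsTab (2 * N) (shape lam) (T.toIndex N) := by
  have hmem (i p : ℕ) : (i, i + p) ∈ shiftedDiagram lam ↔ i < diagLen (shape lam) p := by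
    rw [mem_shiftedDiagram h]
    simp
  have hlt (c) : (T.entry c).index < 2 * N := by
    have := hT c
    rw [Letter.abs_eq_index_div] at this
    omega
  have hpos {i p : ℕ} (hip : (i, i + p) ∈ shiftedDiagram lam) :
      T.toIndex N i p = (T.entry ⟨(i, i + p), hip⟩).index := dif_pos hip
  have hneg {i p : ℕ} (hip : (i, i + p) ∉ shiftedDiagram lam) : T.toIndex N i p = 2 * N :=
    dif_neg hip
  have hle (i p : ℕ) : T.toIndex N i p ≤ 2 * N := by
    by_cases hip : (i, i + p) ∈ shiftedDiagram lam
    · rw [hpos hip]; exact (hlt _).le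
    · exact (hneg hip).le
  have hiff (i p : ℕ) : T.toIndex N i p < 2 * N ↔ (i, i + p) ∈ shiftedDiagram lam := by
    by_cases hip : (i, i + p) ∈ shiftedDiagram lam
    · simp only [hpos hip, hlt, hip]
    · simp [hneg hip, hip]
  have hrow (i p : ℕ) (hip : (i, i + (p + 1)) ∈ shiftedDiagram lam) :
      (i, i + p) ∈ shiftedDiagram lam := by
    rw [hmem] at hip ⊢
    exact hip.trans_le (diagLen_succ_le _ _)
  have hcol (i p : ℕ) (hip : (i + 1, (i + 1) + p) ∈ shiftedDiagram lam) :
      (i, i + (p + 1)) ∈ shiftedDiagram lam := by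
    rw [hmem] at hip ⊢
    have := diagLen_le_succ (shape lam) p
    omega
  refine ⟨hle, fun i p => (hiff i p).trans (hmem i p), ?_, ?_, ?_, ?_, ?_⟩
  · intro i p
    by_cases hip : (i, i + (p + 1)) ∈ shiftedDiagram lam
    · rw [hpos hip, hpos (hrow i p hip), ← Letter.le_iff_index]
      exact T.row_le _ _ rfl (by simp)
    · rw [hneg hip]; exact hle _ _
  · intro i p
    by_cases hip : (i + 1, (i + 1) + p) ∈ shiftedDiagram lam
    · rw [hpos hip, hpos (hcol i p hip), ← Letter.le_iff_index]
      exact T.col_le _ _ (by simp only; omega) (by simp)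
    · rw [hneg hip]; exact hle _ _
  · intro i p h1 h2
    have hip := (hiff i (p + 1)).1 (h2 ▸ h1)
    rw [hpos hip, hpos (hrow i p hip)] at h2
    have := T.row_marked ⟨_, hrow i p hip⟩ ⟨_, hip⟩ rfl (by simp) (Letter.index_injective h2)
    rw [Letter.marked_iff] at this
    rw [hpos (hrow i p hip)]
    omega
  · intro i p h1 h2
    have hip := (hiff (i + 1) p).1 (h2 ▸ h1)
    rw [hpos hip, hpos (hcol i p hip)] at h2
    have := T.col_unmarked ⟨_, hcol i p hip⟩ ⟨_, hip⟩ (by simp only; omega) (by simp)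
      (Letter.index_injective h2)
    rw [Letter.marked_iff] at this
    rwa [hpos (hcol i p hip)]
  · intro i h1
    have hip := (hiff i 0).1 h1
    have := T.diag_unmarked ⟨_, hip⟩ rfl
    rw [Letter.marked_iff] at this
    rw [hpos hip]
    omega

theorem IsTab.row_monotone {M : ℕ} {A : Finset ℕ} {T : ℕ → ℕ → ℕ} (hT : IsTab M A T) (i : ℕ) :
    Monotone (T i) :=
  monotone_nat_of_le_succ fun p => hT.row_le i p

theorem IsTab.col_le_add {M : ℕ} {A : Finset ℕ} {T : ℕ → ℕ → ℕ} (hT : IsTab M A T) (i p k : ℕ) :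
    T i (p + k) ≤ T (i + k) p := by
  induction k generalizing p with
  | zero => exact le_rfl
  | succ k ih =>
    have h1 := ih (p + 1)
    have h2 := hT.col_le (i + k) p
    rw [show p + (k + 1) = p + 1 + k by ring]
    exact h1.trans h2

/-- The marked shifted tableau with given indices of letters. -/
def Tab.toMarked {n : ℕ} {lam : n.Partition} (h : lam ∈ Nat.Partition.distincts n) {N : ℕ}
    (T : Tab (2 * N) (shape lam)) : MarkedShiftedTableau lam where
  entry c := Letter.ofIndex (T.1 c.1.1 (c.1.2 - c.1.1))
  row_le := by
    rintro ⟨⟨i, j⟩, hc⟩ ⟨⟨i', j'⟩, hd⟩ h1 h2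
    simp only at h1 h2
    subst h1
    rw [Letter.le_iff_index, Letter.index_ofIndex, Letter.index_ofIndex]
    exact T.2.row_monotone i (by simp only; omega)
  col_le := by
    rintro ⟨⟨i, j⟩, hc⟩ ⟨⟨i', j'⟩, hd⟩ h1 h2
    simp only at h1 h2
    subst h1
    rw [Letter.le_iff_index, Letter.index_ofIndex, Letter.index_ofIndex]
    have h3 := ((mem_shiftedDiagram h).1 hd).1
    have := T.2.col_le_add i (j - i') (i' - i)
    rwa [show j - i' + (i' - i) = j - i by omega, show i + (i' - i) = i' by omega] at this
  row_marked := by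
    rintro ⟨⟨i, j⟩, hc⟩ ⟨⟨i', j'⟩, hd⟩ h1 h2 h3
    simp only at h1 h2 h3
    subst h1
    have h4 := ((mem_shiftedDiagram h).1 hc)
    have h5 := congrArg Letter.index h3
    rw [Letter.index_ofIndex, Letter.index_ofIndex] at h5
    rw [Letter.marked_iff, Letter.index_ofIndex]
    -- The right neighbour is squeezed between two equal entries, so the condition on adjacent cells
    -- applies.
    have h6 := T.2.row_le i (j - i)
    have h7 := T.2.row_monotone i (show j - i + 1 ≤ j' - i by omega)
    have := T.2.row_odd i (j - i) ((T.2.lt_iff _ _).2 h4.2) (by omega)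
    simp only
    omega
  col_unmarked := by
    rintro ⟨⟨i, j⟩, hc⟩ ⟨⟨i', j'⟩, hd⟩ h1 h2 h3
    simp only at h1 h2 h3
    subst h1
    have h4 := ((mem_shiftedDiagram h).1 hc)
    have h4' := ((mem_shiftedDiagram h).1 hd).1
    have h5 := congrArg Letter.index h3
    rw [Letter.index_ofIndex, Letter.index_ofIndex] at h5
    rw [Letter.marked_iff, Letter.index_ofIndex]
    -- There is a lower cell in the column, so the content `j - i` is positive. The cell just below
    -- is squeezed between two equal entries.
    have e : j - i - 1 + 1 = j - i := by omega
    have h6 := T.2.col_le i (j - i - 1)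
    have h7 := T.2.col_le_add (i + 1) (j - i') (i' - i - 1)
    rw [show j - i' + (i' - i - 1) = j - i - 1 by omega,
      show i + 1 + (i' - i - 1) = i' by omega] at h7
    rw [e] at h6
    have := T.2.col_even i (j - i - 1)
    rw [e] at this
    exact this ((T.2.lt_iff _ _).2 h4.2) (by omega)
  diag_unmarked := by
    rintro ⟨⟨i, j⟩, hc⟩ h1
    simp only at h1
    subst h1
    have h4 := ((mem_shiftedDiagram h).1 hc)
    rw [Letter.marked_iff, Letter.index_ofIndex]
    rw [Nat.sub_self] at h4
    have := T.2.diag_odd i ((T.2.lt_iff _ _).2 h4.2)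
    simp only [Nat.sub_self]
    omega

/-- Marked shifted tableaux in the letters of absolute value less than `N`. -/
def boundedEquiv {n : ℕ} {lam : n.Partition} (h : lam ∈ Nat.Partition.distincts n) (N : ℕ) :
    Tab (2 * N) (shape lam) ≃ {T : MarkedShiftedTableau lam // ∀ c, (T.entry c).abs < N} where
  toFun T := ⟨T.toMarked h, fun c => by
    have h1 := (mem_shiftedDiagram h (i := c.1.1) (j := c.1.2)).1 c.2
    have h2 := (T.2.lt_iff _ _).2 h1.2
    change T.1 c.1.1 (c.1.2 - c.1.1) / 2 < N
    omega⟩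
  invFun T := ⟨T.1.toIndex N, T.1.isTab_toIndex h T.2⟩
  left_inv T := by
    apply Subtype.ext
    funext i p
    simp only [MarkedShiftedTableau.toIndex, Tab.toMarked, Letter.index_ofIndex,
      Nat.add_sub_cancel_left]
    split_ifs with hip
    · rfl
    · rw [mem_shiftedDiagram h, Nat.add_sub_cancel_left] at hip
      have h1 := (T.2.lt_iff i p).not.2 (fun h' => hip ⟨by omega, h'⟩)
      have h2 := T.2.le i p
      omega
  right_inv T := by
    apply Subtype.ext
    apply MarkedShiftedTableau.ext_entry
    funext c
    obtain ⟨⟨i, j⟩, hc⟩ := c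
    have h1 := ((mem_shiftedDiagram h).1 hc).1
    have e : i + (j - i) = j := by omega
    simp only [MarkedShiftedTableau.toIndex, Tab.toMarked, e]
    rw [dif_pos hc, Letter.ofIndex_index]

theorem tabWeight_eq_prod {n : ℕ} {lam : n.Partition} (h : lam ∈ Nat.Partition.distincts n)
    (N : ℕ) (x : ℕ → R) (T : Tab (2 * N) (shape lam)) :
    tabWeight x n (2 * N) (shape lam) T =
      ∏ c, x ((boundedEquiv h N T).1.entry c).abs := by
  have h1 : (∏ c, x ((boundedEquiv h N T).1.entry c).abs) =
      ∏ c ∈ shiftedDiagram lam, x (T.1 c.1 (c.2 - c.1) / 2) :=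
    Finset.prod_coe_sort (shiftedDiagram lam) fun c => x (T.1 c.1 (c.2 - c.1) / 2)
  rw [h1, tabWeight, Finset.prod_sigma']
  refine Finset.prod_bij' (fun q _ => (q.2, q.2 + q.1)) (fun c _ => ⟨c.2 - c.1, c.1⟩) ?_ ?_ ?_ ?_ ?_
  · rintro ⟨p, i⟩ hq
    simp only [Finset.mem_sigma, Finset.mem_range] at hq
    rw [mem_shiftedDiagram h]
    simpa using hq.2
  · rintro ⟨i, j⟩ hc
    have h2 := (mem_shiftedDiagram h).1 hc
    simp only [Finset.mem_sigma, Finset.mem_range]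
    refine ⟨?_, h2.2⟩
    by_contra hlt
    rw [diagLen_of_le (subset_range_of_size (size_shape h)) (not_lt.1 hlt)] at h2
    omega
  · rintro ⟨p, i⟩ hq
    simp
  · rintro ⟨i, j⟩ hc
    have h2 := (mem_shiftedDiagram h).1 hc
    simp only [Prod.mk.injEq, true_and]
    omega
  · rintro ⟨p, i⟩ hq
    simp

theorem tabWeight_X {n : ℕ} {lam : n.Partition} (h : lam ∈ Nat.Partition.distincts n)
    (N : ℕ) (T : Tab (2 * N) (shape lam)) :
    tabWeight (fun i => (MvPowerSeries.X i : Series)) n (2 * N) (shape lam) T =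
      MvPowerSeries.monomial (boundedEquiv h N T).1.weight 1 := by
  rw [tabWeight_eq_prod h, MarkedShiftedTableau.weight]
  simp only [MvPowerSeries.X_def, MvPowerSeries.prod_monomial, Finset.prod_const_one]

theorem MarkedShiftedTableau.abs_lt {n : ℕ} {lam : n.Partition} (T : MarkedShiftedTableau lam)
    {N : ℕ} (hd : ∀ i, N ≤ i → T.weight i = 0) (c) : (T.entry c).abs < N := by
  by_contra hlt
  have h1 := hd _ (not_lt.1 hlt)
  rw [MarkedShiftedTableau.weight, Finsupp.finsetSum_apply, Finset.sum_eq_zero_iff] at h1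
  simpa using h1 c (Finset.mem_univ c)

theorem MarkedShiftedTableau.weight_eq_zero {n : ℕ} {lam : n.Partition}
    (T : MarkedShiftedTableau lam) {N : ℕ} (hT : ∀ c, (T.entry c).abs < N) (i : ℕ) (hi : N ≤ i) :
    T.weight i = 0 := by
  rw [MarkedShiftedTableau.weight, Finsupp.finsetSum_apply]
  refine Finset.sum_eq_zero fun c _ => ?_
  rw [Finsupp.single_apply, if_neg]
  have := hT c
  omega

open Classical in
theorem coeff_schurP_eq_card {n : ℕ} {lam : n.Partition} (h : lam ∈ Nat.Partition.distincts n)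
    (N : ℕ) (d : ℕ →₀ ℕ) (hd : ∀ i, N ≤ i → d i = 0) :
    MvPowerSeries.coeff d (schurP lam) = ((Finset.univ.filter
      fun T : Tab (2 * N) (shape lam) => (boundedEquiv h N T).1.weight = d).card : ℚ) := by
  rw [MvPowerSeries.coeff_apply, schurP, Nat.cast_inj, ← Fintype.card_subtype,
    ← Nat.card_eq_fintype_card]
  refine Nat.card_congr ?_
  symm
  refine ((boundedEquiv h N).subtypeEquiv (q := fun T => T.1.weight = d) fun _ => Iff.rfl).trans ?_
  refine (Equiv.subtypeSubtypeEquivSubtypeInter _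
    fun T : MarkedShiftedTableau lam => T.weight = d).trans ?_
  refine Equiv.subtypeEquivRight fun T => ?_
  refine ⟨fun h => h.2, fun h => ⟨T.abs_lt fun i hi => ?_, h⟩⟩
  rw [h]
  exact hd i hi

theorem coeff_schurP {n : ℕ} {lam : n.Partition} (h : lam ∈ Nat.Partition.distincts n)
    (N : ℕ) (d : ℕ →₀ ℕ) (hd : ∀ i, N ≤ i → d i = 0) :
    MvPowerSeries.coeff d (schurP lam) = MvPowerSeries.coeff d
      (branchP n (fun i => (MvPowerSeries.X i : Series)) N (shape lam)) := by
  classical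
  rw [coeff_schurP_eq_card h N d hd,
    ← tabSum_eq_branchP _ N (subset_range_of_size (size_shape h)), tabSum, map_sum,
    Finset.card_filter, Nat.cast_sum]
  refine Finset.sum_congr rfl fun T _ => ?_
  rw [tabWeight_X h, MvPowerSeries.coeff_monomial]
  simp [eq_comm]

theorem evalOnes_schurP {n : ℕ} {lam : n.Partition} (h : lam ∈ Nat.Partition.distincts n)
    (m : ℕ) : evalOnes m (schurP lam) = branchP n (fun _ => (1 : ℚ)) m (shape lam) := by
  classical
  rw [← tabSum_eq_branchP _ m (subset_range_of_size (size_shape h)), tabSum, evalOnes]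
  simp only [tabWeight, Finset.prod_const_one, Finset.sum_const, nsmul_one]
  set w := fun T : Tab (2 * m) (shape lam) => (boundedEquiv h m T).1.weight with hw
  have h1 : (∑ᶠ (d : ℕ →₀ ℕ) (_ : d ∈ {d : ℕ →₀ ℕ | ∀ i, m ≤ i → d i = 0}),
      MvPowerSeries.coeff d (schurP lam)) = ∑ d ∈ Finset.univ.image w,
      MvPowerSeries.coeff d (schurP lam) := by
    apply finsum_mem_eq_sum_of_inter_support_eq
    ext d
    simp only [Set.mem_inter_iff, Set.mem_ofPred_eq, Function.mem_support, Finset.coe_image,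
      Finset.coe_univ, Set.image_univ, Set.mem_range]
    constructor
    · rintro ⟨hd, hne⟩
      refine ⟨?_, hne⟩
      rw [coeff_schurP_eq_card h m d hd] at hne
      obtain ⟨T, hT⟩ := Finset.card_pos.1 (Nat.pos_of_ne_zero fun h0 => hne (by rw [h0]; simp))
      exact ⟨T, (Finset.mem_filter.1 hT).2⟩
    · rintro ⟨⟨T, rfl⟩, hne⟩
      exact ⟨(boundedEquiv h m T).1.weight_eq_zero (boundedEquiv h m T).2, hne⟩
  refine h1.trans ?_
  have h2 := Finset.card_eq_sum_card_image w Finset.univ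
  rw [h2, Nat.cast_sum]
  refine Finset.sum_congr rfl fun d hd => ?_
  obtain ⟨T, -, rfl⟩ := Finset.mem_image.1 hd
  exact coeff_schurP_eq_card h m _
    ((boundedEquiv h m T).1.weight_eq_zero (boundedEquiv h m T).2)

end ShiftedParking

end

noncomputable section

namespace ShiftedParking

/-! ### The cycle index of the symmetric group -/

/-- The order of the centralizer of a permutation whose cycle lengths are given by `s`. -/
def centralizerOrder (s : Multiset ℕ) : ℕ := s.prod * ∏ k ∈ s.toFinset, (s.count k).factorial

theorem centralizerOrder_cons (k : ℕ) (s : Multiset ℕ) :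
    centralizerOrder (k ::ₘ s) = centralizerOrder s * (k * (s.count k + 1)) := by
  have h1 : ∏ i ∈ (k ::ₘ s).toFinset, ((k ::ₘ s).count i).factorial =
      (s.count k + 1) * ∏ i ∈ s.toFinset, (s.count i).factorial := by
    have h2 : ∏ i ∈ s.toFinset, (s.count i).factorial =
        ∏ i ∈ (k ::ₘ s).toFinset, (s.count i).factorial := by
      refine Finset.prod_subset (fun i hi => ?_) fun i _ hi => ?_
      · rw [Multiset.mem_toFinset] at hi ⊢
        exact Multiset.mem_cons_of_mem hi
      · rw [Multiset.mem_toFinset] at hi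
        rw [Multiset.count_eq_zero_of_notMem hi, Nat.factorial_zero]
    have hk : k ∈ (k ::ₘ s).toFinset := by simp
    rw [h2, ← Finset.mul_prod_erase _ _ hk, ← Finset.mul_prod_erase _ _ hk, ← mul_assoc,
      Multiset.count_cons_self, Nat.factorial_succ]
    congr 1
    refine Finset.prod_congr rfl fun i hi => ?_
    rw [Multiset.count_cons_of_ne (Finset.ne_of_mem_erase hi)]
  rw [centralizerOrder, h1, Multiset.prod_cons, centralizerOrder]
  ring

theorem centralizerOrder_pos {s : Multiset ℕ} (h : ∀ k ∈ s, 0 < k) : 0 < centralizerOrder s :=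
  Nat.mul_pos (Nat.pos_of_ne_zero (Multiset.prod_ne_zero fun h0 => lt_irrefl 0 (h 0 h0)))
    (Finset.prod_pos fun _ _ => Nat.factorial_pos _)

theorem centralizerOrder_add_replicate {s : Multiset ℕ} (hs : 1 ∉ s) (c : ℕ) :
    centralizerOrder (s + Multiset.replicate c 1) = c.factorial * centralizerOrder s := by
  induction c with
  | zero => simp
  | succ c ih =>
    rw [Multiset.replicate_succ, Multiset.add_cons, centralizerOrder_cons, ih,
      Multiset.count_add, Multiset.count_eq_zero_of_notMem hs, Multiset.count_replicate_self,
      Nat.factorial_succ]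
    ring

/-- `cycleType` omits fixed points, so the parts equal to 1 are split off; they contribute the
factorial of their number to the centralizer order. -/
theorem card_parts_partition_eq {n : ℕ} (μ : n.Partition) :
    (Finset.univ.filter fun w : Equiv.Perm (Fin n) => w.partition.parts = μ.parts).card *
      centralizerOrder μ.parts = n.factorial := by
  classical
  set m := μ.parts.filter (2 ≤ ·) with hm
  have h1 : μ.parts = m + Multiset.replicate (n - m.sum) 1 := by
    have h2 : μ.parts.filter (fun k => ¬ 2 ≤ k) =
        Multiset.replicate (Multiset.card (μ.parts.filter (fun k => ¬ 2 ≤ k))) 1 := by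
      rw [Multiset.eq_replicate]
      refine ⟨rfl, fun k hk => ?_⟩
      rw [Multiset.mem_filter] at hk
      have := μ.parts_pos hk.1
      omega
    have h3 := Multiset.filter_add_not (2 ≤ ·) μ.parts
    rw [h2, ← hm] at h3
    have h4 := congrArg Multiset.sum h3
    rw [Multiset.sum_add, Multiset.sum_replicate, μ.parts_sum, smul_eq_mul, mul_one] at h4
    rw [show n - m.sum = Multiset.card (μ.parts.filter (fun k => ¬ 2 ≤ k)) by omega, h3]
  have hsum : m.sum ≤ n := by
    have h4 := congrArg Multiset.sum h1
    rw [Multiset.sum_add, μ.parts_sum] at h4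
    omega
  have h2 : ∀ k ∈ m, 2 ≤ k := fun k hk => (Multiset.mem_filter.1 hk).2
  have h3 := Equiv.Perm.card_of_cycleType_mul_eq (Fin n) m
  rw [Fintype.card_fin, if_pos ⟨hsum, h2⟩] at h3
  have h4 : centralizerOrder μ.parts = (n - m.sum).factorial * centralizerOrder m := by
    rw [h1, centralizerOrder_add_replicate]
    intro h
    have := h2 1 h
    omega
  have h5 : (Finset.univ.filter fun w : Equiv.Perm (Fin n) => w.partition.parts = μ.parts) =
      Finset.univ.filter fun w : Equiv.Perm (Fin n) => w.cycleType = m := by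
    refine Finset.filter_congr fun w _ => ⟨fun h => ?_, fun h => ?_⟩
    · rw [← Equiv.Perm.filter_parts_partition_eq_cycleType, h]
    · rw [Equiv.Perm.parts_partition, h1, h, ← Equiv.Perm.sum_cycleType, h, Fintype.card_fin]
  rw [h5, h4, ← h3, centralizerOrder]
  ring

variable {A : Type*} [CommRing A] [Algebra ℚ A]

/-- The cycle index of the symmetric group on `n` letters. -/
def cycleIndex (a : ℕ → A) (n : ℕ) : A :=
  ∑ μ : n.Partition, ((centralizerOrder μ.parts : ℚ)⁻¹) • (μ.parts.map a).prod

theorem sum_perm_eq_cycleIndex (a : ℕ → A) (n : ℕ) :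
    ((n.factorial : ℚ)⁻¹) • ∑ w : Equiv.Perm (Fin n), (w.partition.parts.map a).prod =
      cycleIndex a n := by
  classical
  let g : Equiv.Perm (Fin n) → n.Partition := fun w =>
    ⟨w.partition.parts, w.partition.parts_pos, w.partition.parts_sum.trans (Fintype.card_fin n)⟩
  rw [cycleIndex, ← Finset.sum_fiberwise_of_maps_to (g := g) (t := Finset.univ)
    (fun _ _ => Finset.mem_univ _), Finset.smul_sum]
  refine Finset.sum_congr rfl fun μ _ => ?_
  have h1 : ∀ w ∈ Finset.univ.filter (fun w => g w = μ),
      (w.partition.parts.map a).prod = (μ.parts.map a).prod := by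
    intro w hw
    rw [← (Finset.mem_filter.1 hw).2]
  have h2 : (Finset.univ.filter fun w => g w = μ) =
      Finset.univ.filter fun w : Equiv.Perm (Fin n) => w.partition.parts = μ.parts :=
    Finset.filter_congr fun w _ => Nat.Partition.ext_iff
  rw [Finset.sum_congr rfl h1, Finset.sum_const, h2, ← Nat.cast_smul_eq_nsmul ℚ, smul_smul]
  congr 1
  have h3 := card_parts_partition_eq μ
  have h4 := centralizerOrder_pos (fun k hk => μ.parts_pos (i := k) hk)
  have h5 : (n.factorial : ℚ) ≠ 0 := by positivity
  rw [← h3] at h5 ⊢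
  push_cast at h5 ⊢
  have h6 := left_ne_zero_of_mul h5
  have h7 := right_ne_zero_of_mul h5
  field_simp

theorem cycleIndex_zero (a : ℕ → A) : cycleIndex a 0 = 1 := by
  rw [cycleIndex, Fintype.sum_unique]
  simp [centralizerOrder]

/-- Newton's identity `n h_n = ∑ p_k h_{n-k}`: write `n = ∑ k m_k(μ)` and remove one part `k`, which
divides the centralizer order by `k m_k(μ)`. -/
theorem smul_cycleIndex (a : ℕ → A) (n : ℕ) :
    (n : ℚ) • cycleIndex a n = ∑ k ∈ Finset.Icc 1 n, a k * cycleIndex a (n - k) := by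
  classical
  have hn (μ : n.Partition) : (n : ℚ) = ∑ k ∈ Finset.Icc 1 n, ((k * μ.parts.count k : ℕ) : ℚ) := by
    rw [← Nat.cast_sum, Nat.cast_inj]
    have h1 : ∑ k ∈ μ.parts.toFinset, μ.parts.count k • k = n :=
      (Finset.sum_multiset_count μ.parts).symm.trans μ.parts_sum
    rw [← Finset.sum_subset (s₁ := μ.parts.toFinset)]
    · refine h1.symm.trans (Finset.sum_congr rfl fun k _ => ?_)
      rw [smul_eq_mul, mul_comm]
    · intro k hk
      rw [Multiset.mem_toFinset] at hk
      exact Finset.mem_Icc.2 ⟨μ.parts_pos hk, Nat.Partition.le_of_mem_parts hk⟩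
    · intro k _ hk
      rw [Multiset.mem_toFinset] at hk
      rw [Multiset.count_eq_zero_of_notMem hk, mul_zero]
  have h1 : (n : ℚ) • cycleIndex a n = ∑ k ∈ Finset.Icc 1 n, ∑ μ : n.Partition,
      (((k * μ.parts.count k : ℕ) : ℚ) * (centralizerOrder μ.parts : ℚ)⁻¹) •
        (μ.parts.map a).prod := by
    rw [cycleIndex, Finset.smul_sum, Finset.sum_comm]
    refine Finset.sum_congr rfl fun μ _ => ?_
    rw [← Finset.sum_smul, ← Finset.sum_mul, ← hn μ, smul_smul]
  rw [h1]
  refine Finset.sum_congr rfl fun k hk => ?_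
  rw [Finset.mem_Icc] at hk
  rw [cycleIndex, Finset.mul_sum, ← (Nat.Partition.partitionWithPartEquiv hk.1 hk.2).sum_comp]
  rw [← Finset.sum_filter_of_ne (p := fun μ : n.Partition => k ∈ μ.parts)]
  · rw [Finset.sum_subtype (p := fun μ : n.Partition => k ∈ μ.parts) _ (by simp)]
    refine Finset.sum_congr rfl fun μ _ => ?_
    rw [Nat.Partition.partitionWithPartEquiv_apply_parts]
    obtain ⟨s, hs⟩ := Multiset.exists_cons_of_mem μ.2
    rw [hs, Multiset.erase_cons_head, centralizerOrder_cons, Multiset.map_cons,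
      Multiset.prod_cons, Multiset.count_cons_self, mul_smul_comm]
    congr 1
    have h2 : 0 < centralizerOrder s := centralizerOrder_pos fun i hi =>
      μ.1.parts_pos (hs ▸ Multiset.mem_cons_of_mem hi)
    have h3 : (k : ℚ) ≠ 0 := by
      have := hk.1
      positivity
    push_cast
    have h4 : (Multiset.count k s : ℚ) + 1 ≠ 0 := by positivity
    field_simp
  · intro μ _ hne
    by_contra h
    rw [Multiset.count_eq_zero_of_notMem h] at hne
    simp at hne

/-! ### The generating function of the cycle indices -/

open PowerSeries in
-- Since `c` has no constant term, the coefficient of degree `n + 1` is determined by lower ones up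
-- to the factor `n + 1`, a unit in a `ℚ`-algebra.
theorem eq_of_X_mul_derivative {F G c : A⟦X⟧} (hc : constantCoeff c = 0)
    (hF : X * d⁄dX A F = c * F) (hG : X * d⁄dX A G = c * G)
    (h0 : constantCoeff F = constantCoeff G) : F = G := by
  have key : ∀ n, ∀ k ≤ n, coeff k F = coeff k G := by
    intro n
    induction n with
    | zero =>
      intro k hk
      obtain rfl := Nat.le_zero.1 hk
      simpa using h0
    | succ n ih =>
      intro k hk
      rcases Nat.le_succ_iff.1 hk with hk | rfl
      · exact ih k hk
      have h1 := congrArg (coeff (n + 1)) hF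
      have h2 := congrArg (coeff (n + 1)) hG
      rw [coeff_succ_X_mul, coeff_derivative, coeff_mul] at h1 h2
      have h3 : ∑ p ∈ Finset.HasAntidiagonal.antidiagonal (n + 1), coeff p.1 c * coeff p.2 F =
          ∑ p ∈ Finset.HasAntidiagonal.antidiagonal (n + 1), coeff p.1 c * coeff p.2 G := by
        refine Finset.sum_congr rfl fun p hp => ?_
        rw [Finset.HasAntidiagonal.mem_antidiagonal] at hp
        rcases Nat.eq_zero_or_pos p.1 with h | h
        · rw [h, coeff_zero_eq_constantCoeff_apply, hc, zero_mul, zero_mul]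
        · rw [ih p.2 (by omega)]
      rw [h3, ← h2] at h1
      have h4 : IsUnit ((n : A) + 1) := by
        have : IsUnit (algebraMap ℚ A ((n : ℚ) + 1)) :=
          (IsUnit.mk0 ((n : ℚ) + 1) (by positivity)).map _
        simpa using this
      exact h4.mul_right_cancel h1
  ext n
  exact key n n le_rfl

open PowerSeries in
theorem X_mul_derivative_one_add {S : Type*} [CommRing S] (x : S) :
    X * d⁄dX S (1 + X * C x) = (PowerSeries.mk fun k => -(-x) ^ k) * (1 + X * C x) +
      (1 + X * C x) := by
  have h : (PowerSeries.mk fun k => (-x) ^ k) * (1 + X * C x) = 1 := by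
    ext n
    rw [mul_add, mul_one, ← mul_assoc, map_add, coeff_mul_C, coeff_mk]
    cases n with
    | zero => simp
    | succ n => rw [coeff_succ_mul_X, coeff_mk, coeff_one]; simp [pow_succ]
  have h2 : (PowerSeries.mk fun k => -(-x) ^ k) = -(PowerSeries.mk fun k => (-x) ^ k) := by
    ext; simp
  rw [h2, neg_mul, h]
  simp

open PowerSeries in
theorem X_mul_derivative_prod {S : Type*} [CommRing S] (N : ℕ) (f c : ℕ → S⟦X⟧)
    (h : ∀ i, X * d⁄dX S (f i) = c i * f i) :
    X * d⁄dX S (∏ i ∈ Finset.range N, f i) =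
      (∑ i ∈ Finset.range N, c i) * ∏ i ∈ Finset.range N, f i := by
  induction N with
  | zero => simp
  | succ N ih =>
    rw [Finset.prod_range_succ, Finset.sum_range_succ, Derivation.leibniz, smul_eq_mul,
      smul_eq_mul]
    linear_combination (∏ i ∈ Finset.range N, f i) * h N + f N * ih

open PowerSeries in
theorem X_mul_derivative_pow {S : Type*} [CommRing S] (m : ℕ) (f c : S⟦X⟧)
    (h : X * d⁄dX S f = c * f) :
    X * d⁄dX S (f ^ m) = ((m : S⟦X⟧) * c) * f ^ m := by
  have := X_mul_derivative_prod m (fun _ => f) (fun _ => c) fun _ => h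
  simpa using this

open PowerSeries in
/-- The generating function of the cycle indices in the case of the superfication of `m` copies
of the alphabet `x`. -/
theorem prod_mul_mk_cycleIndex (N m : ℕ) (x : ℕ → A) :
    (∏ i ∈ Finset.range N, (1 - X * C (x i))) ^ m *
      PowerSeries.mk (cycleIndex fun k => (m : A) *
        ∑ i ∈ Finset.range N, (x i ^ k - (-x i) ^ k)) =
      (∏ i ∈ Finset.range N, (1 + X * C (x i))) ^ m := by
  set a : ℕ → A := fun k => (m : A) * ∑ i ∈ Finset.range N, (x i ^ k - (-x i) ^ k) with ha
  set S := PowerSeries.mk (cycleIndex a)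
  have hS : X * d⁄dX A S = PowerSeries.mk a * S := by
    ext n
    cases n with
    | zero => simp [ha]
    | succ n =>
      rw [coeff_succ_X_mul, coeff_derivative, coeff_mul,
        Finset.Nat.sum_antidiagonal_eq_sum_range_succ
          (fun i j => coeff i (PowerSeries.mk a) * coeff j S), Finset.sum_range_succ']
      simp only [S, coeff_mk]
      have h0 : a 0 = 0 := by simp [ha]
      have h1 := smul_cycleIndex a (n + 1)
      rw [Algebra.smul_def] at h1
      simp only [Nat.cast_add, Nat.cast_one, map_add, map_natCast, map_one] at h1
      rw [h0, zero_mul, add_zero, mul_comm, h1, Finset.range_eq_Ico,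
        Finset.sum_Ico_add' (fun k => a k * cycleIndex a (n + 1 - k)) 0 (n + 1) 1]
      rfl
  have hplus (y : A) : X * d⁄dX A (1 + X * C y) =
      (1 + PowerSeries.mk fun k => -(-y) ^ k) * (1 + X * C y) := by
    rw [X_mul_derivative_one_add]; ring
  have hV := X_mul_derivative_pow m _ _
    (X_mul_derivative_prod N (fun i => 1 + X * C (x i)) _ fun i => hplus (x i))
  have hU := X_mul_derivative_pow m _ _
    (X_mul_derivative_prod N (fun i => 1 + X * C (-x i)) _ fun i => hplus (-x i))
  have hneg : ∀ i, (1 : A⟦X⟧) + X * C (-x i) = 1 - X * C (x i) := fun i => by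
    rw [map_neg]; ring
  simp only [hneg, neg_neg] at hU
  refine eq_of_X_mul_derivative ?_ ?_ hV ?_
  · simp
  · rw [Derivation.leibniz, smul_eq_mul, smul_eq_mul]
    -- The logarithmic derivatives match: `1 + X x` contributes `1 - 1 / (1 + X x)` and `1 - X x`
    -- contributes `1 - 1 / (1 - X x)`.
    have hc : PowerSeries.mk a + (m : A⟦X⟧) *
        (∑ i ∈ Finset.range N, (1 + PowerSeries.mk fun k => -(x i) ^ k)) =
        (m : A⟦X⟧) * ∑ i ∈ Finset.range N, (1 + PowerSeries.mk fun k => -(-x i) ^ k) := by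
      have h1 : PowerSeries.mk a = (m : A⟦X⟧) *
          ∑ i ∈ Finset.range N, PowerSeries.mk fun k => (x i ^ k - (-x i) ^ k) := by
        ext k
        rw [← map_natCast (C (R := A)), coeff_C_mul, map_sum]
        simp [ha]
      rw [h1, ← mul_add, ← Finset.sum_add_distrib]
      congr 1
      refine Finset.sum_congr rfl fun i _ => ?_
      ext k
      simp only [map_add, coeff_mk]
      ring
    set U := (∏ i ∈ Finset.range N, (1 - X * C (x i))) ^ m
    linear_combination U * hS + S * hU + U * S * hc
  · simp [S, map_prod, cycleIndex_zero]

end ShiftedParking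

end

noncomputable section

namespace ShiftedParking

/-! ### Permutation characters -/

theorem character_ofMulAction {G X : Type*} [Group G] [MulAction G X] [Finite X] (g : G) :
    (Representation.ofMulAction ℚ G X).character g = (Nat.card {a : X // g • a = a} : ℚ) := by
  classical
  have : Fintype X := Fintype.ofFinite X
  let b : Module.Basis X ℚ (MonoidAlgebra ℚ X) :=
    Module.Basis.ofRepr (MonoidAlgebra.coeffLinearEquiv ℚ)
  have hb (a : X) : b a = MonoidAlgebra.single a 1 := rfl
  rw [Representation.character, LinearMap.trace_eq_matrix_trace ℚ b, Matrix.trace,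
    Nat.card_eq_fintype_card, Fintype.card_subtype, Finset.card_filter, Nat.cast_sum]
  refine Finset.sum_congr rfl fun a _ => ?_
  rw [Matrix.diag_apply, LinearMap.toMatrix_apply, hb, Representation.ofMulAction_single]
  change Finsupp.single (g • a) (1 : ℚ) a = _
  rw [Finsupp.single_apply]
  split_ifs <;> simp

/-- The orbits are the nontrivial cycles, each represented by the base point chosen by `b`, together
with the fixed points. -/
theorem card_quotient_sameCycle {α : Type*} [Fintype α] [DecidableEq α] (w : Equiv.Perm α) :
    Nat.card (Quotient (Equiv.Perm.SameCycle.setoid w)) = w.partition.parts.card := by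
  classical
  obtain ⟨b⟩ := Equiv.Perm.Basis.nonempty w
  let g : w.cycleFactorsFinset ⊕ {x // w x = x} → Quotient (Equiv.Perm.SameCycle.setoid w) :=
    Sum.elim (fun c => Quotient.mk _ (b c)) fun x => Quotient.mk _ x.1
  have hfix {x y : α} (hx : w x = x) (h : w.SameCycle x y) : x = y := by
    obtain ⟨k, hk⟩ := h
    rw [← hk]
    exact (Equiv.Perm.zpow_apply_eq_self_of_apply_eq_self hx k).symm
  have hbne (c : w.cycleFactorsFinset) : w (b c) ≠ b c := by
    have h1 := b.mem_support_self c
    have h2 := Equiv.Perm.mem_cycleFactorsFinset_support_le c.2 h1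
    exact Equiv.Perm.mem_support.1 h2
  have hg : Function.Bijective g := by
    constructor
    · rintro (c | ⟨x, hx⟩) (c' | ⟨y, hy⟩) h
      · have h1 : w.SameCycle (b c) (b c') := Quotient.exact h
        have h2 := h1.cycleOf_eq
        rw [b.cycleOf_eq, b.cycleOf_eq] at h2
        rw [Subtype.ext h2]
      · have h1 : w.SameCycle (b c) y := Quotient.exact h
        exact absurd (by rw [← hfix hy h1.symm]; exact hy) (hbne c)
      · have h1 : w.SameCycle x (b c') := Quotient.exact h
        exact absurd (by rw [← hfix hx h1]; exact hx) (hbne c')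
      · have h1 : w.SameCycle x y := Quotient.exact h
        obtain rfl := hfix hx h1
        rfl
    · intro q
      obtain ⟨x, rfl⟩ := Quotient.exists_rep q
      by_cases hx : w x = x
      · exact ⟨Sum.inr ⟨x, hx⟩, rfl⟩
      · have hc := Equiv.Perm.cycleOf_mem_cycleFactorsFinset_iff.2 (Equiv.Perm.mem_support.2 hx)
        refine ⟨Sum.inl ⟨_, hc⟩, Quotient.sound ?_⟩
        change w.SameCycle _ _
        rw [Equiv.Perm.sameCycle_iff_cycleOf_eq_of_mem_support
          (Equiv.Perm.mem_support.2 (hbne _)) (Equiv.Perm.mem_support.2 hx), b.cycleOf_eq]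
  rw [← Nat.card_congr (Equiv.ofBijective g hg), Nat.card_sum, Equiv.Perm.parts_partition,
    Multiset.card_add, Multiset.card_replicate, Equiv.Perm.cycleType_def, Multiset.card_map]
  congr 1
  · simp
  · rw [Nat.card_eq_fintype_card, Fintype.card_subtype, ← Finset.card_compl]
    congr 1
    ext x
    simp

theorem card_comp_eq {α Y : Type*} [Fintype α] [DecidableEq α] (w : Equiv.Perm α) :
    Nat.card {f : α → Y // f ∘ w = f} = Nat.card Y ^ w.partition.parts.card := by
  have hf {f : α → Y} (h : f ∘ w = f) (x y : α) (hxy : w.SameCycle x y) : f x = f y := by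
    obtain ⟨k, rfl⟩ := hxy.exists_nat_pow_eq
    induction k with
    | zero => rfl
    | succ k ih =>
      rw [pow_succ', Equiv.Perm.mul_apply, ih]
      · exact (congrFun h _).symm
      · exact ⟨k, by simp⟩
  let e : {f : α → Y // f ∘ w = f} ≃ (Quotient (Equiv.Perm.SameCycle.setoid w) → Y) :=
    { toFun := fun f => Quotient.lift f.1 (hf f.2)
      invFun := fun g => ⟨fun x => g (Quotient.mk _ x), by
        funext x
        exact congrArg g (Quotient.sound (Equiv.Perm.sameCycle_apply_left.2
          (Equiv.Perm.SameCycle.refl w x)))⟩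
      left_inv := fun f => rfl
      right_inv := fun g => by
        funext q
        induction q using Quotient.inductionOn with
        | h x => rfl }
  rw [Nat.card_congr e, Nat.card_fun, card_quotient_sameCycle]

/-! ### Counting parking functions -/

theorem isParking_iff {n : ℕ} (a : Fin n → ℕ) : IsParking a ↔ (∀ i, 1 ≤ a i) ∧
    ∀ j ≤ n, j ≤ (Finset.univ.filter fun i => a i ≤ j).card := by
  refine and_congr_right fun _ => ?_
  have hcard (j : ℕ) : (Finset.univ.filter fun i => a i ≤ j).card =
      (Finset.univ.filter fun i => (a ∘ Tuple.sort a) i ≤ j).card := by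
    symm
    refine Finset.card_equiv (Tuple.sort a) fun i => ?_
    simp
  have hmono := Tuple.monotone_sort a
  constructor
  · intro h j hj
    rw [hcard]
    conv_lhs => rw [← Fintype.card_fin j, ← Finset.card_univ]
    refine Finset.card_le_card_of_injOn (Fin.castLE hj) (fun i _ => ?_)
      (Fin.castLE_injective hj).injOn
    simp only [Finset.coe_filter, Finset.mem_univ, true_and, Set.mem_ofPred_eq]
    refine (h _).trans ?_
    have := i.2
    simp only [Fin.val_castLE]
    omega
  · intro h i
    by_contra hlt
    rw [not_le] at hlt
    have h1 := h (i + 1) i.2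
    rw [hcard] at h1
    have h2 : (Finset.univ.filter fun k => (a ∘ Tuple.sort a) k ≤ (i : ℕ) + 1) ⊆
        Finset.Iio i := by
      intro k hk
      rw [Finset.mem_filter] at hk
      rw [Finset.mem_Iio]
      by_contra hik
      have := hmono (not_lt.1 hik)
      have := hk.2
      omega
    have h3 := Finset.card_le_card h2
    rw [Fin.card_Iio] at h3
    omega

theorem IsParking.le {n : ℕ} {a : Fin n → ℕ} (h : IsParking a) (i : Fin n) : a i ≤ n := by
  have h1 := ((isParking_iff a).1 h).2 n le_rfl
  have h2 : (Finset.univ.filter fun i => a i ≤ n) = Finset.univ := by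
    rw [← Finset.card_eq_iff_eq_univ, Fintype.card_fin]
    refine le_antisymm ((Finset.card_le_univ _).trans (Fintype.card_fin n).le) h1
  have h3 := Finset.mem_univ i
  rw [← h2] at h3
  exact (Finset.mem_filter.1 h3).2

instance (n : ℕ) : Finite (ParkingFunction n) := by
  refine Finite.of_injective (β := Fin n → Fin (n + 1))
    (fun a i => ⟨a.1 i, Nat.lt_succ_of_le (a.2.le i)⟩) fun a b h => Subtype.ext (funext fun i => ?_)
  exact congrArg Fin.val (congrFun h i)

/-! ### Rotation of functions on a circle -/

/-- The cycle lemma. -/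
theorem existsUnique_forall_le_of_add_period {S : ℕ → ℤ} {m : ℕ} (hm : 0 < m)
    (hS : ∀ k, S (k + m) = S k - 1) : ∃! r, r < m ∧ ∀ j < m, S r ≤ S (r + j) := by
  classical
  have hex : ∃ r, r < m ∧ ∀ k < m, S r ≤ S k := by
    obtain ⟨r, hr, h⟩ := Finset.exists_min_image (Finset.range m) S ⟨0, Finset.mem_range.2 hm⟩
    exact ⟨r, Finset.mem_range.1 hr, fun k hk => h k (Finset.mem_range.2 hk)⟩
  -- The witness is the first minimum in a period. Past the end of the period `S` has dropped by 1,
  -- but the indices reached there precede the first minimum, where `S` is larger by at least 1.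
  have hgood : ∀ j < m, S (Nat.find hex) ≤ S (Nat.find hex + j) := by
    intro j hj
    by_cases h : Nat.find hex + j < m
    · exact (Nat.find_spec hex).2 _ h
    · obtain ⟨i, hi⟩ := Nat.exists_eq_add_of_le' (not_lt.1 h)
      have h1 := Nat.find_min hex (m := i) (by omega)
      have h2 := (Nat.find_spec hex).1
      push Not at h1
      obtain ⟨k, hk, hlt⟩ := h1 (by omega)
      have h3 := (Nat.find_spec hex).2 k hk
      rw [hi, hS]
      omega
  have key : ∀ r r', r < r' → r' < m → (∀ j < m, S r ≤ S (r + j)) →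
      (∀ j < m, S r' ≤ S (r' + j)) → False := by
    intro r r' h1 h2 h3 h4
    have h5 := h3 (r' - r) (by omega)
    have h6 := h4 (r + m - r') (by omega)
    rw [show r' + (r + m - r') = r + m by omega, hS] at h6
    rw [show r + (r' - r) = r' by omega] at h5
    omega
  refine ⟨Nat.find hex, ⟨(Nat.find_spec hex).1, hgood⟩, ?_⟩
  rintro r ⟨hr, h⟩
  rcases lt_trichotomy r (Nat.find hex) with hlt | heq | hlt
  · exact (key _ _ hlt (Nat.find_spec hex).1 h hgood).elim
  · exact heq
  · exact (key _ _ hlt hr hgood h).elim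

theorem card_val_sub_lt {n j : ℕ} (hj : j ≤ n + 1) (f : Fin n → ZMod (n + 1)) (r : ℕ) :
    (Finset.univ.filter fun i => (f i - r).val < j).card =
      ∑ l ∈ Finset.range j,
        (Finset.univ.filter fun i => f i = ((r + l : ℕ) : ZMod (n + 1))).card := by
  rw [Finset.card_eq_sum_card_fiberwise (f := fun i => (f i - r).val) (t := Finset.range j)]
  · refine Finset.sum_congr rfl fun l hl => ?_
    rw [Finset.mem_range] at hl
    congr 1
    ext i
    simp only [Finset.mem_filter, Finset.mem_univ, true_and, Nat.cast_add]
    constructor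
    · rintro ⟨-, h⟩
      rw [← h, ZMod.natCast_zmod_val]
      ring
    · intro h
      rw [h, add_sub_cancel_left, ZMod.val_natCast_of_lt (by omega)]
      exact ⟨hl, rfl⟩
  · intro i hi
    simpa using hi

theorem existsUnique_rotation {n : ℕ} (f : Fin n → ZMod (n + 1)) :
    ∃! c : ZMod (n + 1), ∀ j ≤ n, j ≤ (Finset.univ.filter fun i => (f i - c).val < j).card := by
  -- Each place of the circle contributes its number of preimages minus 1. There are `n` preimages
  -- and `n + 1` places, so the partial sums drop by 1 per turn; the parking condition from `r` on
  -- says that they do not fall below `S r`.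
  let t : ℕ → ℤ := fun l =>
    ((Finset.univ.filter fun i => f i = (l : ZMod (n + 1))).card : ℤ) - 1
  let S : ℕ → ℤ := fun k => ∑ l ∈ Finset.range k, t l
  have hS (r : ℕ) {j : ℕ} (hj : j ≤ n + 1) : S (r + j) = S r +
      ((Finset.univ.filter fun i => (f i - r).val < j).card : ℤ) - j := by
    simp only [S, Finset.sum_range_add]
    rw [card_val_sub_lt hj, Nat.cast_sum]
    simp only [t, Finset.sum_sub_distrib, Finset.sum_const, Finset.card_range]
    simp
    ring
  have hper (k : ℕ) : S (k + (n + 1)) = S k - 1 := by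
    rw [hS k le_rfl, Finset.filter_true_of_mem fun i _ => ZMod.val_lt _]
    simp
    ring
  have hiff (r : ℕ) : (∀ j < n + 1, S r ≤ S (r + j)) ↔
      ∀ j ≤ n, j ≤ (Finset.univ.filter fun i => (f i - r).val < j).card := by
    refine forall_congr' fun j => ?_
    rw [Nat.lt_succ_iff]
    refine forall_congr' fun hj => ?_
    rw [hS r (by omega)]
    omega
  obtain ⟨r, ⟨hr, h1⟩, huniq⟩ := existsUnique_forall_le_of_add_period (Nat.succ_pos n) hper
  refine ⟨(r : ZMod (n + 1)), (hiff r).1 h1, fun c hc => ?_⟩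
  rw [← huniq c.val ⟨ZMod.val_lt c, (hiff _).2 ?_⟩, ZMod.natCast_zmod_val]
  rwa [ZMod.natCast_zmod_val]

theorem val_natCast_sub_one {n a : ℕ} (h1 : 1 ≤ a) (h2 : a ≤ n) :
    ((a - 1 : ℕ) : ZMod (n + 1)).val = a - 1 :=
  ZMod.val_natCast_of_lt (by omega)

/-- Pollak's argument, compatible with `w`: every function to the circle is a unique rotation of a
parking function, and rotation commutes with permuting coordinates. A function fixed by `w` is a
free choice of one value per cycle. -/
theorem card_fixed_mul {n : ℕ} (w : Equiv.Perm (Fin n)) :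
    Nat.card {a : ParkingFunction n // w • a = a} * (n + 1) =
      (n + 1) ^ w.partition.parts.card := by
  have hsmul (a : ParkingFunction n) : w • a = a ↔ a.1 ∘ w = a.1 := by
    refine ⟨fun h => funext fun i => ?_, fun h => Subtype.ext (funext fun i => ?_)⟩
    · have h1 : a.1 (w⁻¹ (w i)) = a.1 (w i) := congrFun (congrArg Subtype.val h) (w i)
      rw [Equiv.Perm.inv_def, Equiv.symm_apply_apply] at h1
      exact h1.symm
    · have h1 : a.1 (w (w⁻¹ i)) = a.1 (w⁻¹ i) := congrFun h (w⁻¹ i)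
      rw [Equiv.Perm.inv_def, Equiv.apply_symm_apply] at h1
      exact h1.symm
  have h := card_comp_eq (Y := ZMod (n + 1)) w
  rw [Nat.card_zmod] at h
  rw [← h]
  conv_lhs => rw [← Nat.card_zmod (n + 1)]
  rw [← Nat.card_prod]
  let Ψ : {a : ParkingFunction n // w • a = a} × ZMod (n + 1) →
      {f : Fin n → ZMod (n + 1) // f ∘ w = f} := fun q =>
    ⟨fun i => ((q.1.1.1 i - 1 : ℕ) : ZMod (n + 1)) + q.2, by
      funext i
      have := congrFun ((hsmul _).1 q.1.2) i
      simp only [Function.comp_apply] at this ⊢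
      rw [this]⟩
  have hval (q) (i) : ((Ψ q).1 i - q.2).val = q.1.1.1 i - 1 := by
    change (((q.1.1.1 i - 1 : ℕ) : ZMod (n + 1)) + q.2 - q.2).val = _
    rw [add_sub_cancel_right, val_natCast_sub_one (q.1.1.2.1 i) (q.1.1.2.le i)]
  have hgood (q) : ∀ j ≤ n, j ≤ (Finset.univ.filter fun i => ((Ψ q).1 i - q.2).val < j).card := by
    intro j hj
    refine (((isParking_iff _).1 q.1.1.2).2 j hj).trans_eq ?_
    congr 1
    refine Finset.filter_congr fun i _ => ?_
    have := q.1.1.2.1 i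
    rw [hval]
    omega
  refine Nat.card_congr (Equiv.ofBijective Ψ ⟨fun q q' hq => ?_, fun f => ?_⟩)
  · have h1 := hgood q
    rw [hq] at h1
    have h2 : q.2 = q'.2 := (existsUnique_rotation (Ψ q').1).unique h1 (hgood q')
    refine Prod.ext (Subtype.ext (Subtype.ext (funext fun i => ?_))) h2
    have h3 := hval q i
    rw [hq, h2, hval q' i] at h3
    have := q.1.1.2.1 i
    have := q'.1.1.2.1 i
    omega
  · obtain ⟨c, hc, -⟩ := existsUnique_rotation f.1
    have hpark : IsParking fun i => (f.1 i - c).val + 1 :=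
      (isParking_iff _).2 ⟨fun i => Nat.le_add_left _ _, hc⟩
    refine ⟨(⟨⟨_, hpark⟩, (hsmul _).2 ?_⟩, c), Subtype.ext (funext fun i => ?_)⟩
    · funext i
      have := congrFun f.2 i
      simp only [Function.comp_apply] at this ⊢
      rw [this]
    · change (((f.1 i - c).val + 1 - 1 : ℕ) : ZMod (n + 1)) + c = f.1 i
      rw [Nat.add_sub_cancel, ZMod.natCast_zmod_val, sub_add_cancel]

theorem character_parking {n : ℕ} (w : Equiv.Perm (Fin n)) :
    (Representation.ofMulAction ℚ (Equiv.Perm (Fin n)) (ParkingFunction n)).character w =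
      ((n : ℚ) + 1)⁻¹ * ((n : ℚ) + 1) ^ w.partition.parts.card := by
  have h := card_fixed_mul w
  rw [character_ofMulAction, eq_inv_mul_iff_mul_eq₀ (by positivity), mul_comm]
  exact_mod_cast h

end ShiftedParking

end

noncomputable section

namespace ShiftedParking

/-! ### Restriction to finitely many variables -/

/-- Set all but the first `N` variables to zero. -/
def restrictVars (N : ℕ) : Series →ₐ[ℚ] Series :=
  MvPowerSeries.rescaleAlgHom fun i => if i < N then 1 else 0

open Classical in
theorem coeff_restrictVars (N : ℕ) (f : Series) (d : ℕ →₀ ℕ) :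
    MvPowerSeries.coeff d (restrictVars N f) =
      if ∀ i, N ≤ i → d i = 0 then MvPowerSeries.coeff d f else 0 := by
  have h : restrictVars N f = MvPowerSeries.rescale (fun i => if i < N then (1 : ℚ) else 0) f := by
    rw [restrictVars, MvPowerSeries.rescaleAlgHom_apply]
  rw [h, MvPowerSeries.coeff_rescale]
  split_ifs with hd
  · rw [Finsupp.prod, Finset.prod_eq_one, one_mul]
    intro i hi
    rw [if_pos, one_pow]
    by_contra hlt
    exact Finsupp.mem_support_iff.1 hi (hd i (not_lt.1 hlt))
  · push Not at hd
    obtain ⟨i, hi, hne⟩ := hd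
    rw [Finsupp.prod, Finset.prod_eq_zero (Finsupp.mem_support_iff.2 hne), zero_mul]
    rw [if_neg (not_lt.2 hi), zero_pow hne]

theorem eq_of_restrictVars_eq {f g : Series} (h : ∀ N, restrictVars N f = restrictVars N g) :
    f = g := by
  classical
  ext d
  have hd : ∀ i, d.support.sup id + 1 ≤ i → d i = 0 := by
    intro i hi
    by_contra hne
    have : i ≤ d.support.sup id := Finset.le_sup (f := id) (Finsupp.mem_support_iff.2 hne)
    omega
  have h1 := congrArg (MvPowerSeries.coeff d) (h (d.support.sup id + 1))
  rwa [coeff_restrictVars, coeff_restrictVars, if_pos hd, if_pos hd] at h1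

theorem restrictVars_powerSum (N k : ℕ) (hk : 1 ≤ k) :
    restrictVars N (powerSum k) = ∑ i ∈ Finset.range N, (MvPowerSeries.X i : Series) ^ k := by
  classical
  ext d
  rw [coeff_restrictVars, coeff_powerSum, map_sum]
  simp only [MvPowerSeries.coeff_X_pow]
  by_cases hex : ∃ i, d = Finsupp.single i k
  · obtain ⟨i, rfl⟩ := hex
    have h1 : ∀ j, (Finsupp.single i k = Finsupp.single j k) ↔ i = j := fun j =>
      (Finsupp.single_left_injective (by omega : k ≠ 0)).eq_iff
    simp only [h1, exists_eq', if_true, Finset.sum_ite_eq, Finset.mem_range]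
    refine if_congr ⟨fun h => ?_, fun h j hj => ?_⟩ rfl rfl
    · by_contra hlt
      have := h i (not_lt.1 hlt)
      rw [Finsupp.single_eq_same] at this
      omega
    · rw [Finsupp.single_apply, if_neg (by omega)]
  · rw [if_neg hex, ite_self, Finset.sum_eq_zero]
    intro i _
    rw [if_neg fun h => hex ⟨i, h⟩]

theorem restrictVars_schurP {n : ℕ} {lam : n.Partition} (h : lam ∈ Nat.Partition.distincts n)
    (N : ℕ) : restrictVars N (schurP lam) =
      branchP n (fun i => (MvPowerSeries.X i : Series)) N (shape lam) := by
  classical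
  ext d
  rw [coeff_restrictVars]
  split_ifs with hd
  · exact coeff_schurP h N d hd
  · rw [← tabSum_eq_branchP _ N (subset_range_of_size (size_shape h)), tabSum, map_sum,
      Finset.sum_eq_zero]
    intro T _
    rw [tabWeight_X h, MvPowerSeries.coeff_monomial, if_neg]
    rintro rfl
    exact hd ((boundedEquiv h N T).1.weight_eq_zero (boundedEquiv h N T).2)

/-! ### The shifted parking function symmetric function -/

theorem shiftification_symP (k : ℕ) (hk : 1 ≤ k) :
    shiftification (symP k) = symP k + (-1 : ℚ) ^ (k - 1) • symP k := by
  simp [shiftification, superfication, twoAlphabets, omega, symLift_symP _ k hk]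

theorem restrictVars_shiftification_symP (N k : ℕ) (hk : 1 ≤ k) :
    restrictVars N (shiftification (symP k) : Series) = ∑ i ∈ Finset.range N,
      ((MvPowerSeries.X i : Series) ^ k - (-MvPowerSeries.X i) ^ k) := by
  obtain ⟨k, rfl⟩ := Nat.exists_eq_add_of_le' hk
  rw [shiftification_symP _ hk]
  simp only [Subalgebra.coe_add, Subalgebra.coe_smul, coe_symP _ hk, map_add, map_smul,
    restrictVars_powerSum _ _ hk, Nat.add_sub_cancel]
  rw [Finset.smul_sum, ← Finset.sum_add_distrib]
  refine Finset.sum_congr rfl fun i _ => ?_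
  rw [neg_pow (MvPowerSeries.X i : Series) (k + 1), sub_eq_add_neg, pow_succ (-1 : Series)]
  congr 1
  rw [Algebra.smul_def, map_pow, map_neg, map_one]
  ring

/-- The character is `(n + 1)⁻¹` times one factor `n + 1` per cycle, and each such factor is
absorbed into the power sum of its cycle. -/
theorem restrictVars_shiftedParkingSym (N n : ℕ) :
    restrictVars N (shiftedParkingSym n : Series) = ((n : ℚ) + 1)⁻¹ •
      cycleIndex (fun k => ((n + 1 : ℕ) : Series) * ∑ i ∈ Finset.range N,
        ((MvPowerSeries.X i : Series) ^ k - (-MvPowerSeries.X i) ^ k)) n := by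
  let F : Sym →ₐ[ℚ] Series := ((restrictVars N).comp Sym.val).comp shiftification
  change F (parkingSym n) = _
  rw [← sum_perm_eq_cycleIndex, parkingSym, frobeniusCh, map_smul, map_sum, smul_comm]
  congr 1
  rw [Finset.smul_sum]
  refine Finset.sum_congr rfl fun w _ => ?_
  rw [map_smul, character_parking, mul_smul, symPPart, map_multiset_prod, Multiset.map_map,
    Multiset.prod_map_mul, Multiset.map_const', Multiset.prod_replicate]
  congr 1
  rw [Algebra.smul_def]
  congr 1
  · simp
  · congr 1
    refine Multiset.map_congr rfl fun k hk => ?_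
    exact restrictVars_shiftification_symP N k (w.partition.parts_pos hk)

theorem restrictVars_sum_schurP (N n : ℕ) :
    restrictVars N (∑ lam ∈ Nat.Partition.distincts n,
      ((2 : ℚ) ^ lam.parts.card * evalOnes (n + 1) (schurP lam)) • schurP lam) =
      cycleIndex (fun k => ((n + 1 : ℕ) : Series) * ∑ i ∈ Finset.range N,
        ((MvPowerSeries.X i : Series) ^ k - (-MvPowerSeries.X i) ^ k)) n := by
  have h := coeff_cauchy n N (n + 1) (fun i => (MvPowerSeries.X i : Series)) _
    (prod_mul_mk_cycleIndex N (n + 1) _)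
  rw [PowerSeries.coeff_mk] at h
  rw [h, ← sum_distincts n (fun A => 2 ^ A.card * branchP n (fun _ => (1 : Series)) (n + 1) A *
    branchP n (fun i => (MvPowerSeries.X i : Series)) N A), map_sum]
  refine Finset.sum_congr rfl fun lam hlam => ?_
  rw [map_smul, restrictVars_schurP hlam, evalOnes_schurP hlam, card_shape hlam,
    Algebra.smul_def, map_mul, map_branchP, map_pow, map_ofNat]
  simp only [map_one]

end ShiftedParking

end

theorem theorem2 (n : ℕ) :
    (ShiftedParking.shiftedParkingSym n : MvPowerSeries ℕ ℚ) =
      ((n : ℚ) + 1)⁻¹ • ∑ lam ∈ Nat.Partition.distincts n,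
        ((2 : ℚ) ^ lam.parts.card * ShiftedParking.evalOnes (n + 1) (ShiftedParking.schurP lam)) •
          ShiftedParking.schurP lam := by
  refine ShiftedParking.eq_of_restrictVars_eq fun N => ?_
  rw [ShiftedParking.restrictVars_shiftedParkingSym, map_smul,
    ShiftedParking.restrictVars_sum_schurP]
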